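/- Let $K$ be a field, $c\ge 1$ an integer, and $R_n=K[x_{k,j}\mid 1\le k\le c,\ 1\le j\le n]$ for $n\ge 1$, with the standard grading. For a nonzero finitely generated graded $R_n$-module $M$ let $\operatorname{reg}(M)=\max\{j-p\mid \operatorname{Tor}_p^{R_n}(K,M)_j\neq 0\}$ be its Castelnuovo–Mumford regularity. For $i\ge 0$ let $\mathrm{Inc}(\mathbb N)^i$ be the monoid of strictly increasing maps $\pi:\mathbb{Z}_{\ge 1}\to\mathbb{Z}_{\ge 1}$ with $\pi(j)=j$ for all $j\le i$, and for $m\le n$ let $\mathrm{Inc}(\mathbb N)^i_{m,n}=\{\pi\in\mathrm{Inc}(\mathbb N)^i\mid \pi(m)\le n\}$; each such $\pi$ acts as $R_m\to R_n$, $x_{k,j}\mapsto x_{k,\pi(j)}$. A sequence $\mathcal I=(I_n)_{n\ge 1}$ of ideals $I_n\subseteq R_n$ is an $\mathrm{Inc}(\mathbb N)^i$-invariant chain if $\mathrm{Inc}(\mathbb N)^i_{m,n}(I_m)\subseteq I_n$ for all $m\le n$. Its stability index $\operatorname{ind}^i(\mathcal I)$ is the least $r\ge 1$ such that $I_n=\langle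 \mathrm{Inc}(\mathbb N)^i_{m,n}(I_m)\rangle_{R_n}$ for all $n\ge m\ge r$ (such an $r$ always exists). Let $\mathcal F$ be the family of all pairs $(i,\mathcal I)$ where $i\ge 0$ is an integer and $\mathcal I=(I_n)_{n\ge1}$ is an $\mathrm{Inc}(\mathbb N)^i$-invariant chain of monomial ideals, not all of them zero. For $(i,\mathcal I)\in\mathcal F$ with $r=\operatorname{ind}^i(\mathcal I)$ and $\mathbf e=(e_1,\dots,e_c)\in\mathbb Z_{\ge0}^c$, let $|\mathbf e|=e_1+\cdots+e_c$ and let $\mathcal I_{\mathbf e}=(I_{\mathbf e,n})_{n\ge1}$ be the chain with $$I_{\mathbf e,n}=\langle I_n:x_{1,i+1}^{e_1}\cdots x_{c,i+1}^{e_c},\ x_{1,i+1},\dots,x_{c,i+1}\rangle\quad\text{if } n\ge \max\{r,i\}+1,$$ and $I_{\mathbf e,n}=0$ if $n\le\max\{r,i\}$. A subfamily $\mathcal E\subseteq\mathcal F$ is called extremal if for every $(i,\mathcal I)\in\mathcal E$ there is a subset $E(\mathcal I)\subseteq\mathbb Z_{\ge 0}^c$ such that (X1) $(i+1,\mathcal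 I_{\mathbf e})\in\mathcal E$ for all $\mathbf e\in E(\mathcal I)$, and (X2) $\operatorname{reg}(I_n)=\max\{\operatorname{reg}(I_{\mathbf e,n})+|\mathbf e|\mid \mathbf e\in E(\mathcal I)\}$ for all $n\gg0$ (in particular, this maximum exists). **Theorem.** Let $\mathcal E$ be an extremal subfamily of $\mathcal F$. Then for every $(i,\mathcal I)\in\mathcal E$ with $\mathcal I=(I_n)_{n\ge 1}$ there exist integers $\mathcal C(\mathcal I)$ and $\mathcal D(\mathcal I)$ such that $$\operatorname{reg}(I_n)=\mathcal C(\mathcal I)\,n+\mathcal D(\mathcal I)\quad\text{for all } n\gg0.$$ -/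

import Mathlib

open MvPolynomial

/-! ## Castelnuovo–Mumford regularity

Let `S = K[x_s | s ∈ σ]` with `σ` finite, and let `M` be a graded `S`-module with graded pieces
`ℳ j`, `j ∈ ℤ`. The Koszul complex on the variables is a graded free resolution of `K = S/(x_s)`,
so `Tor^S_p(K, M)` is the `p`-th homology of the complex `⋀^p(K^σ) ⊗_K M`, where the basis vectors
of `⋀^p(K^σ)` have degree `p`. An element of `⋀^p(K^σ) ⊗_K M` is written as the alternating
`p`-linear map of its coefficients. -/

section Regularity

variable (σ K : Type*) [Fintype σ] [DecidableEq σ] [Field K]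
variable (M : Type*) [AddCommGroup M] [Module (MvPolynomial σ K) M] [Module K M]
  [IsScalarTower K (MvPolynomial σ K) M]

/-- The Koszul differential `⋀^{p+1}(K^σ) ⊗ M → ⋀^p(K^σ) ⊗ M`: the contraction with
`∑ x_s e_s`, i.e. `(∂f)(v₁, …, v_p) = ∑ₛ x_s · f(e_s, v₁, …, v_p)`. -/
noncomputable def koszulD (p : ℕ) :
    ((σ → K) [⋀^Fin (p + 1)]→ₗ[K] M) →ₗ[K] ((σ → K) [⋀^Fin p]→ₗ[K] M) where
  toFun f := ∑ s : σ, (Algebra.lsmul K K M (X s : MvPolynomial σ K)).compAlternatingMap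
    (f.curryLeft (Pi.single s 1))
  map_add' f g := by
    rw [← Finset.sum_add_distrib]
    refine Finset.sum_congr rfl fun s _ => ?_
    ext v
    simp
  map_smul' a f := by
    rw [Finset.smul_sum]
    refine Finset.sum_congr rfl fun s _ => ?_
    ext v
    exact smul_comm (X s : MvPolynomial σ K) a _

/-- The Koszul cycles in homological degree `p`. -/
noncomputable def koszulCycles : (p : ℕ) → Submodule K ((σ → K) [⋀^Fin p]→ₗ[K] M)
  | 0 => ⊤
  | p + 1 => LinearMap.ker (koszulD σ K M p)

variable {K M}

/-- The piece of internal degree `j` of `⋀^p(K^σ) ⊗ M`: all coefficients lie in `ℳ (j - p)`. -/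
def koszulPiece (ℳ : ℤ → Submodule K M) (p : ℕ) (j : ℤ) :
    Submodule K ((σ → K) [⋀^Fin p]→ₗ[K] M) where
  carrier := {f | ∀ v, f v ∈ ℳ (j - p)}
  add_mem' hf hg v := by simpa using (ℳ (j - p)).add_mem (hf v) (hg v)
  zero_mem' v := by simp
  smul_mem' a f hf v := by simpa using (ℳ (j - p)).smul_mem a (hf v)

/-- The graded piece `Tor^S_p(K, M)_j`: cycles of internal degree `j` modulo boundaries of
chains of internal degree `j`. -/
abbrev GradedTor (ℳ : ℤ → Submodule K M) (p : ℕ) (j : ℤ) : Type _ :=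
  ↥(koszulCycles σ K M p ⊓ koszulPiece σ ℳ p j) ⧸
    ((koszulPiece σ ℳ (p + 1) j).map (koszulD σ K M p)).submoduleOf
      (koszulCycles σ K M p ⊓ koszulPiece σ ℳ p j)

/-- `reg M = max {j - p | Tor_p(K, M)_j ≠ 0}`. (For a nonzero finitely generated graded module
this set of integers is nonempty and bounded above, so the supremum is a maximum.) -/
noncomputable def gradedReg (ℳ : ℤ → Submodule K M) : ℤ :=
  sSup {m | ∃ (p : ℕ) (j : ℤ), Nontrivial (GradedTor σ ℳ p j) ∧ m = j - p}

variable {σ}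

/-- The standard grading on an ideal `J` of a polynomial ring: degree `j` consists of the elements
of `J` all of whose monomials have degree `j`. -/
def Ideal.stdGrading (J : Ideal (MvPolynomial σ K)) (j : ℤ) : Submodule K J where
  carrier := {f | ∀ m : σ →₀ ℕ, (f : MvPolynomial σ K).coeff m ≠ 0 → (m.degree : ℤ) = j}
  add_mem' {f g} hf hg m hm := by
    by_cases h : (f : MvPolynomial σ K).coeff m = 0
    · exact hg m fun h' => hm (by simp [h, h'])
    · exact hf m h
  zero_mem' m hm := absurd (by simp) hm
  smul_mem' a f hf m hm := hf m fun h => hm (by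
    rw [Submodule.coe_smul_of_tower, coeff_smul, h, smul_zero])

/-- The Castelnuovo–Mumford regularity of a graded ideal, as a graded module. -/
noncomputable def Ideal.reg (J : Ideal (MvPolynomial σ K)) : ℤ := gradedReg σ J.stdGrading

/-- A monomial ideal: an ideal generated by monomials. -/
def Ideal.IsMonomialIdeal (J : Ideal (MvPolynomial σ K)) : Prop :=
  ∃ A : Set (σ →₀ ℕ), J = Ideal.span ((fun a => monomial a (1 : K)) '' A)

end Regularity

/-! ## Invariant chains

`R_n = K[x_{k,j} | k ∈ [c], j ∈ [n]]`. Rows and columns are numbered from `0`, so the variable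
`x_{k,j}` (with `1 ≤ j ≤ n`) is `X (k - 1, j - 1)`, and a function `π` on the positive integers
becomes the function `j ↦ π (j + 1) - 1` on `ℕ`. -/

namespace IncChain

/-- The polynomial ring `R_n` in `c × n` variables. -/
abbrev PolyRing (K : Type*) [Field K] (c n : ℕ) : Type _ := MvPolynomial (Fin c × Fin n) K

/-- A sequence `(I_n)_{n ≥ 1}` of ideals `I_n ⊆ R_n`. -/
abbrev Chain (K : Type*) [Field K] (c : ℕ) : Type _ := (n : ℕ+) → Ideal (PolyRing K c n)

/-- The monoid `Inc(ℕ)^i` of strictly increasing functions fixing the first `i` numbers. -/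
def Inc (i : ℕ) : Set (ℕ → ℕ) := {π | StrictMono π ∧ ∀ j < i, π j = j}

variable {K : Type*} [Field K] {c : ℕ}

/-- For `π` mapping the first `m` columns into the first `n` columns, the action
`x_{k,j} ↦ x_{k,π(j)}` of `π` as a map `R_m → R_n`. -/
noncomputable def act {m n : ℕ} (π : ℕ → ℕ) (h : ∀ j : Fin m, π j < n) :
    PolyRing K c m →ₐ[K] PolyRing K c n :=
  rename fun x => (x.1, ⟨π x.2, h x.2⟩)

/-- The set `Inc(ℕ)^i_{m,n}(I_m) ⊆ R_n`. -/
def orbit (i : ℕ) (I : Chain K c) (m n : ℕ+) : Set (PolyRing K c n) :=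
  {g | ∃ π ∈ Inc i, ∃ h : ∀ j : Fin m, π j < n, ∃ f ∈ I m, g = act π h f}

/-- `Inc(ℕ)^i`-invariance of a chain. -/
def IsInvariant (i : ℕ) (I : Chain K c) : Prop :=
  ∀ m n : ℕ+, m ≤ n → orbit i I m n ⊆ I n

/-- The `i`-stability index `ind^i(I)`: the least `r ≥ 1` such that
`I_n = ⟨Inc(ℕ)^i_{m,n}(I_m)⟩` for all `n ≥ m ≥ r`. -/
noncomputable def ind (i : ℕ) (I : Chain K c) : ℕ :=
  sInf {r | 1 ≤ r ∧ ∀ m n : ℕ+, r ≤ m → m ≤ n → I n = Ideal.span (orbit i I m n)}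

/-- The chain `I_e`: with `r = ind^i(I)`, its `n`-th ideal is
`⟨I_n : x_{1,i+1}^{e_1} ⋯ x_{c,i+1}^{e_c}, x_{1,i+1}, …, x_{c,i+1}⟩` for `n > r`, and `0` for
`n ≤ r`. (It is also `0` if `n ≤ i`, when the variables `x_{k,i+1}` do not belong to `R_n`.) -/
noncomputable def colonChain (i : ℕ) (I : Chain K c) (e : Fin c → ℕ) : Chain K c := fun n =>
  if h : ind i I < n ∧ i < n then
    (I n).colon {∏ k : Fin c, X (k, ⟨i, h.2⟩) ^ e k} ⊔
      Ideal.span (Set.range fun k : Fin c => X (k, ⟨i, h.2⟩))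
  else ⊥

/-- The family `𝓕` of all pairs `(i, I)` with `I` a nonzero `Inc(ℕ)^i`-invariant chain of
monomial ideals. -/
def family (K : Type*) [Field K] (c : ℕ) : Set (ℕ × Chain K c) :=
  {p | (∃ n, p.2 n ≠ ⊥) ∧ (∀ n, (p.2 n).IsMonomialIdeal) ∧ IsInvariant p.1 p.2}

/-- Extremal subfamilies of `𝓕`. -/
def IsExtremal (𝓔 : Set (ℕ × Chain K c)) : Prop :=
  𝓔 ⊆ family K c ∧
  ∀ (i : ℕ) (I : Chain K c), (i, I) ∈ 𝓔 → ∃ E : Set (Fin c → ℕ),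
    (∀ e ∈ E, (i + 1, colonChain i I e) ∈ 𝓔) ∧
    ∀ᶠ n : ℕ+ in Filter.atTop,
      IsGreatest ((fun e => (colonChain i I e n).reg + ∑ k, (e k : ℤ)) '' E) (I n).reg

end IncChain

/-! Passing from `I` to `I_e` adjoins one more column of variables to the ideals. Once those
variables are discarded, two cases remain. Either the monomials outside them form, in large degree
of `n`, the same set as before. Then `I_{e,n+1}` is `I_n` with a new column of variables adjoined,
and its regularity is `reg I_n`. Or that set has grown strictly, which cannot happen indefinitely.

To compare all chains reached from one start `(i, I)`, a monomial is recorded as a word: its first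
`i` columns, followed by the list of columns after the `k` adjoined ones. The invariance of the
chain makes the set of words upward closed for a quasi-order that is a well-quasi-order by the
lemmas of Dickson and Higman. Hence strict growth, disregarding short words, is well-founded
(`wellFounded_eventuallySubset`), and `eventuallyLinear_reg` is an induction along it. The set
`E(I)` is finite by `finite_of_isGreatest`, so (X2) becomes a recursion `f (n + 1) = max (L (n + 1))
(f n + a)` with `L` eventually linear by induction (either entry may be absent).
`eventuallyLinear_of_isGreatest` solves it.

The algebraic input is `Koszul.IsRetract.reg_eq`: adjoining variables to a nonzero homogeneous ideal
keeps the regularity. It is proved by explicit homotopies on the Koszul complex. The only new value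
of `j - p` is `1`, from the new generators, and this is dominated unless the ideal is the whole
ring. -/

set_option linter.unusedSectionVars false

namespace Koszul

/-! ### Contraction and exterior multiplication on alternating maps. -/

section Operators

variable {R V M N : Type*} [CommRing R] [AddCommGroup V] [Module R V] [AddCommGroup M] [Module R M]
  [AddCommGroup N] [Module R N]

/-- The exterior product `ε ∧ g` of a linear form and an alternating map. -/
def wedge (ε : V →ₗ[R] R) {p : ℕ} (g : V [⋀^Fin p]→ₗ[R] M) : V [⋀^Fin (p + 1)]→ₗ[R] M :=
  AlternatingMap.alternatizeUncurryFin (ε.smulRight g)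

lemma wedge_apply (ε : V →ₗ[R] R) {p : ℕ} (g : V [⋀^Fin p]→ₗ[R] M) (v : Fin (p + 1) → V) :
    wedge ε g v = ∑ i : Fin (p + 1), (-1) ^ (i : ℕ) • ε (v i) • g (i.removeNth v) := by
  simp [wedge, AlternatingMap.alternatizeUncurryFin_apply]

lemma wedge_add (ε : V →ₗ[R] R) {p : ℕ} (f g : V [⋀^Fin p]→ₗ[R] M) :
    wedge ε (f + g) = wedge ε f + wedge ε g := by
  ext v
  simp [wedge_apply, Finset.sum_add_distrib]

lemma wedge_zero (ε : V →ₗ[R] R) {p : ℕ} :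
    wedge ε (0 : V [⋀^Fin p]→ₗ[R] M) = 0 := by
  ext v
  simp [wedge_apply]

lemma alternatingMap_sum_apply {p : ℕ} {ι : Type*} (s : Finset ι) (f : ι → V [⋀^Fin p]→ₗ[R] M)
    (v : Fin p → V) : (∑ i ∈ s, f i) v = ∑ i ∈ s, f i v := by
  classical
  induction s using Finset.induction_on with
  | empty => simp
  | insert a s ha ih => rw [Finset.sum_insert ha, AlternatingMap.add_apply, ih,
      Finset.sum_insert ha]

lemma wedge_sum (ε : V →ₗ[R] R) {p : ℕ} {ι : Type*} (s : Finset ι)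
    (f : ι → V [⋀^Fin p]→ₗ[R] M) :
    wedge ε (∑ i ∈ s, f i) = ∑ i ∈ s, wedge ε (f i) := by
  classical
  induction s using Finset.induction_on with
  | empty => simp [wedge_zero]
  | insert a s ha ih => rw [Finset.sum_insert ha, wedge_add, ih, Finset.sum_insert ha]

lemma compAlternatingMap_wedge (L : M →ₗ[R] N) (ε : V →ₗ[R] R) {p : ℕ}
    (g : V [⋀^Fin p]→ₗ[R] M) :
    L.compAlternatingMap (wedge ε g) = wedge ε (L.compAlternatingMap g) := by
  ext v
  simp [wedge_apply]

lemma curryLeft_wedge_zero (ε : V →ₗ[R] R) (g : V [⋀^Fin 0]→ₗ[R] M) (x : V) :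
    (wedge ε g).curryLeft x = ε x • g := by
  ext v
  rw [AlternatingMap.curryLeft_apply_apply, wedge_apply]
  simp [Subsingleton.elim (Fin.removeNth 0 (Matrix.vecCons x v)) v]

/-- Contraction is an antiderivation of the exterior algebra; all boundary formulas for `wedge` rest
on this. -/
lemma curryLeft_wedge (ε : V →ₗ[R] R) {p : ℕ} (g : V [⋀^Fin (p + 1)]→ₗ[R] M) (x : V) :
    (wedge ε g).curryLeft x = ε x • g - wedge ε (g.curryLeft x) := by
  ext v
  rw [AlternatingMap.sub_apply, AlternatingMap.curryLeft_apply_apply, wedge_apply,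
    wedge_apply, Fin.sum_univ_succ, sub_eq_add_neg, ← Finset.sum_neg_distrib]
  congr 1
  · simp
  · refine Finset.sum_congr rfl fun i _ => ?_
    have : i.succ.removeNth (Matrix.vecCons x v) = Matrix.vecCons x (i.removeNth v) := by
      ext j
      refine Fin.cases ?_ (fun j => ?_) j
      · simp [Fin.removeNth]
      · simp [Fin.removeNth]
    rw [this]
    simp [pow_succ]

lemma curryLeft_curryLeft_swap {p : ℕ} (g : V [⋀^Fin (p + 2)]→ₗ[R] M) (x y : V) :
    (g.curryLeft x).curryLeft y = -(g.curryLeft y).curryLeft x := by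
  have h := AlternatingMap.curryLeft_same g (x + y)
  simp only [map_add, AlternatingMap.curryLeft_add, LinearMap.add_apply,
    AlternatingMap.curryLeft_same] at h
  rw [eq_neg_iff_add_eq_zero]
  simpa [add_comm] using h

/-- If contraction with every `x - π x` gives zero, a vector may be replaced by its image under `π`
in one slot after another. The transport along `hq` only serves to include `p = 0`, where the
condition is void. -/
lemma eq_compLinearMap_of_curryLeft_eq_zero (π : V →ₗ[R] V) {p : ℕ} (g : V [⋀^Fin p]→ₗ[R] M)
    (h : ∀ (q : ℕ) (hq : p = q + 1) (x : V), (hq ▸ g).curryLeft (x - π x) = 0) :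
    g.compLinearMap π = g := by
  induction p with
  | zero =>
    ext v
    simp only [AlternatingMap.compLinearMap_apply]
    congr 1
    exact Subsingleton.elim _ _
  | succ p ih =>
    have h' : ∀ x, g.curryLeft (π x) = g.curryLeft x := fun x => by
      have := h p rfl x
      simp only [map_sub] at this
      exact (sub_eq_zero.1 this).symm
    ext v
    have hv : v = Matrix.vecCons (v 0) (Fin.tail v) := (Fin.cons_self_tail v).symm
    have e1 : (g.compLinearMap π) v = ((g.curryLeft (v 0)).compLinearMap π) (Fin.tail v) := by
      rw [← h', ← AlternatingMap.curryLeft_compLinearMap, AlternatingMap.curryLeft_apply_apply,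
        ← hv]
    rw [e1, ih]
    · rw [AlternatingMap.curryLeft_apply_apply, ← hv]
    · rintro q rfl x
      simp only
      rw [curryLeft_curryLeft_swap]
      have := h (q + 1) rfl x
      simp only at this
      rw [this]
      simp

end Operators

/-! ### The Koszul differential and operators attached to one variable. -/

section Polynomial

variable {τ K : Type*} [Fintype τ] [DecidableEq τ] [Field K]

/-- The coefficient operator on alternating maps given by multiplication by `X s`. -/
noncomputable abbrev mulX (s : τ) : MvPolynomial τ K →ₗ[K] MvPolynomial τ K :=
  LinearMap.mulLeft K (X s)

/-- The basis vector `e_s`. -/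
abbrev e (s : τ) : τ → K := Pi.single s 1

lemma koszulD_eq {p : ℕ} (f : (τ → K) [⋀^Fin (p + 1)]→ₗ[K] MvPolynomial τ K) :
    koszulD τ K _ p f = ∑ s, (mulX s).compAlternatingMap (f.curryLeft (e s)) := rfl

lemma koszulD_apply {M : Type*} [AddCommGroup M] [Module (MvPolynomial τ K) M] [Module K M]
    [IsScalarTower K (MvPolynomial τ K) M] {p : ℕ} (f : (τ → K) [⋀^Fin (p + 1)]→ₗ[K] M)
    (v : Fin p → τ → K) :
    koszulD τ K M p f v = ∑ s, (X s : MvPolynomial τ K) • f (Matrix.vecCons (e s) v) := by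
  simp [koszulD, alternatingMap_sum_apply]

lemma curryLeft_sum {p : ℕ} {ι : Type*} (t : Finset ι)
    (f : ι → (τ → K) [⋀^Fin (p + 1)]→ₗ[K] MvPolynomial τ K) (x : τ → K) :
    (∑ i ∈ t, f i).curryLeft x = ∑ i ∈ t, (f i).curryLeft x := by
  ext v
  simp [alternatingMap_sum_apply]

lemma curryLeft_koszulD {p : ℕ} (f : (τ → K) [⋀^Fin (p + 2)]→ₗ[K] MvPolynomial τ K) (x : τ → K) :
    (koszulD τ K _ (p + 1) f).curryLeft x = -koszulD τ K _ p (f.curryLeft x) := by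
  rw [koszulD_eq, koszulD_eq, curryLeft_sum, ← Finset.sum_neg_distrib]
  refine Finset.sum_congr rfl fun s _ => ?_
  rw [AlternatingMap.curryLeft_compAlternatingMap, curryLeft_curryLeft_swap]
  ext v
  simp

/-- The coordinate form dual to `e_y`. -/
abbrev form (y : τ) : (τ → K) →ₗ[K] K := LinearMap.proj y

lemma koszulD_wedge_zero (y : τ) (g : (τ → K) [⋀^Fin 0]→ₗ[K] MvPolynomial τ K) :
    koszulD τ K _ 0 (wedge (form y) g) = (mulX y).compAlternatingMap g := by
  rw [koszulD_eq, Finset.sum_eq_single y]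
  · rw [curryLeft_wedge_zero]; simp [e]
  · intro s _ hs
    rw [curryLeft_wedge_zero]
    ext v
    simp [e, hs.symm]
  · simp

/-- Summing the antiderivation rule over all `s` leaves the scalar `form y (e s)` only for `s = y`.
Thus wedging with `form y` is a homotopy from multiplication by `X y` to zero. -/
lemma koszulD_wedge (y : τ) {p : ℕ} (g : (τ → K) [⋀^Fin (p + 1)]→ₗ[K] MvPolynomial τ K) :
    koszulD τ K _ (p + 1) (wedge (form y) g) =
      (mulX y).compAlternatingMap g - wedge (form y) (koszulD τ K _ p g) := by
  rw [koszulD_eq, koszulD_eq, wedge_sum]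
  have : ∀ s, (mulX s).compAlternatingMap ((wedge (form y) g).curryLeft (e s)) =
      (if s = y then (mulX y).compAlternatingMap g else 0) -
        wedge (form y) ((mulX s).compAlternatingMap (g.curryLeft (e s))) := by
    intro s
    rw [curryLeft_wedge, ← compAlternatingMap_wedge]
    split_ifs with h
    · subst h
      ext v
      simp [e, mul_sub]
    · ext v
      simp [e, Ne.symm h]
  simp_rw [this]
  rw [Finset.sum_sub_distrib]
  simp

/-- A coefficient operator `T` commuting with all variables but `y` yields a homotopy. -/
lemma koszulD_homotopy (y : τ) (T : MvPolynomial τ K →ₗ[K] MvPolynomial τ K)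
    (hT : ∀ s ≠ y, ∀ g, T (X s * g) = X s * T g) {p : ℕ}
    (f : (τ → K) [⋀^Fin (p + 1)]→ₗ[K] MvPolynomial τ K) :
    T.compAlternatingMap (koszulD τ K _ p f) = koszulD τ K _ p (T.compAlternatingMap f) +
      (T ∘ₗ mulX y - mulX y ∘ₗ T).compAlternatingMap (f.curryLeft (e y)) := by
  rw [koszulD_eq, koszulD_eq, ← Finset.add_sum_erase _ _ (Finset.mem_univ y),
    ← Finset.add_sum_erase _ _ (Finset.mem_univ y)]
  ext v : 1
  simp only [LinearMap.compAlternatingMap_apply, AlternatingMap.add_apply,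
    alternatingMap_sum_apply, map_add, map_sum, LinearMap.sub_apply, LinearMap.comp_apply,
    AlternatingMap.curryLeft_compAlternatingMap, LinearMap.mulLeft_apply]
  have : ∀ s ∈ Finset.univ.erase y, T (X s * (f.curryLeft (e s)) v) =
      X s * T ((f.curryLeft (e s)) v) := fun s hs => hT s (Finset.ne_of_mem_erase hs) _
  rw [Finset.sum_congr rfl this]
  ring

/-- The projection of `K^τ` killing `e_y`. -/
def proj (y : τ) : (τ → K) →ₗ[K] (τ → K) :=
  LinearMap.id - (form y).smulRight (e y)

lemma proj_e_self (y : τ) : proj y (e y : τ → K) = 0 := by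
  simp [proj, e]

lemma proj_e_of_ne {y s : τ} (h : s ≠ y) : proj y (e s : τ → K) = e s := by
  simp [proj, e, h.symm]

lemma compLinearMap_proj_zero (y : τ) (f : (τ → K) [⋀^Fin 0]→ₗ[K] MvPolynomial τ K) :
    f.compLinearMap (proj y) = f :=
  eq_compLinearMap_of_curryLeft_eq_zero _ _ fun q hq => by omega

lemma compLinearMap_proj_of_curryLeft (y : τ) {p : ℕ}
    (f : (τ → K) [⋀^Fin (p + 1)]→ₗ[K] MvPolynomial τ K)
    (h : f.curryLeft (e y) = 0) : f.compLinearMap (proj y) = f := by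
  refine eq_compLinearMap_of_curryLeft_eq_zero _ _ ?_
  rintro q hq x
  obtain rfl : p = q := by omega
  have : x - proj y x = x y • e y := by simp [proj]
  simp [this, h]

lemma wedge_compLinearMap_proj (y : τ) {p : ℕ}
    (f : (τ → K) [⋀^Fin p]→ₗ[K] MvPolynomial τ K) :
    (wedge (form y) f).compLinearMap (proj y) = 0 := by
  ext v
  have : ∀ x : τ → K, (form y) (proj y x) = 0 := fun x => by simp [proj, e]
  simp only [AlternatingMap.compLinearMap_apply, wedge_apply, this]
  simp

/-- The right side is annihilated by contraction with `e y`, hence fixed by `proj y`, while `proj y`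
kills the wedge term. -/
lemma compLinearMap_proj (y : τ) {p : ℕ}
    (f : (τ → K) [⋀^Fin (p + 1)]→ₗ[K] MvPolynomial τ K) :
    f.compLinearMap (proj y) = f - wedge (form y) (f.curryLeft (e y)) := by
  have h : (f - wedge (form y) (f.curryLeft (e y))).curryLeft (e y) = 0 := by
    have : (f - wedge (form y) (f.curryLeft (e y))).curryLeft (e y) = f.curryLeft (e y) -
        (wedge (form y) (f.curryLeft (e y))).curryLeft (e y) := rfl
    rw [this]
    cases p with
    | zero => rw [curryLeft_wedge_zero]; simp [e]
    | succ p =>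
      rw [curryLeft_wedge, AlternatingMap.curryLeft_same, wedge_zero]; simp [e]
  have h2 := compLinearMap_proj_of_curryLeft y _ h
  have h3 : (f - wedge (form y) (f.curryLeft (e y))).compLinearMap (proj y) =
    f.compLinearMap (proj y) - (wedge (form y) (f.curryLeft (e y))).compLinearMap (proj y) := rfl
  rw [h3, wedge_compLinearMap_proj, sub_zero] at h2
  exact h2

end Polynomial

end Koszul

namespace Koszul

/-! ### Homogeneous polynomials. -/

section Pieces

variable {τ K : Type*} [Field K]

/-- The homogeneous polynomials of degree `d ∈ ℤ`. -/
def degPiece (τ K : Type*) [Field K] (d : ℤ) : Submodule K (MvPolynomial τ K) where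
  carrier := {f | ∀ m : τ →₀ ℕ, f.coeff m ≠ 0 → (m.degree : ℤ) = d}
  add_mem' {f g} hf hg m hm := by
    by_cases h : f.coeff m = 0
    · exact hg m fun h' => hm (by simp [h, h'])
    · exact hf m h
  zero_mem' m hm := absurd (by simp) hm
  smul_mem' a f hf m hm := hf m fun h => hm (by rw [coeff_smul, h, smul_zero])

lemma monomial_mem_degPiece (m : τ →₀ ℕ) (a : K) : monomial m a ∈ degPiece τ K m.degree := by
  classical
  intro n hn
  rw [coeff_monomial] at hn
  split_ifs at hn with h
  · rw [h]
  · exact absurd rfl hn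

lemma map_mem_degPiece {υ : Type*} (L : MvPolynomial τ K →ₗ[K] MvPolynomial υ K) {d d' : ℤ}
    (hL : ∀ (m : τ →₀ ℕ) (a : K), (m.degree : ℤ) = d → L (monomial m a) ∈ degPiece υ K d')
    {f : MvPolynomial τ K} (hf : f ∈ degPiece τ K d) : L f ∈ degPiece υ K d' := by
  rw [f.as_sum, map_sum]
  exact Submodule.sum_mem _ fun m hm => hL m _ (hf m (mem_support_iff.1 hm))

lemma X_mul_mem_degPiece (s : τ) {d : ℤ} {f : MvPolynomial τ K} (hf : f ∈ degPiece τ K (d - 1)) :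
    X s * f ∈ degPiece τ K d := by
  refine map_mem_degPiece (LinearMap.mulLeft K (X s)) (fun m a hm => ?_) hf
  have h := monomial_mem_degPiece (Finsupp.single s 1 + m) a
  rw [LinearMap.mulLeft_apply, X, monomial_mul, one_mul]
  convert h using 1
  simp [map_add, hm]

lemma rename_mem_degPiece {υ : Type*} (i : τ → υ) {d : ℤ} {f : MvPolynomial τ K}
    (hf : f ∈ degPiece τ K d) : rename i f ∈ degPiece υ K d := by
  refine map_mem_degPiece (rename i).toLinearMap (fun m a hm => ?_) hf
  have h := monomial_mem_degPiece (m.mapDomain i) a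
  rw [AlgHom.toLinearMap_apply, rename_monomial]
  rwa [Finsupp.degree_mapDomain, hm] at h

lemma killCompl_mem_degPiece {υ : Type*} {i : τ → υ} (hi : Function.Injective i) {d : ℤ}
    {f : MvPolynomial υ K} (hf : f ∈ degPiece υ K d) : killCompl hi f ∈ degPiece τ K d := by
  refine map_mem_degPiece (killCompl hi).toLinearMap (fun m a hm => ?_) hf
  rw [AlgHom.toLinearMap_apply]
  by_cases h : (m.support : Set υ) ⊆ Set.range i
  · obtain ⟨n, rfl⟩ : ∃ n, Finsupp.mapDomain i n = m :=
      ⟨_, Finsupp.mapDomain_comapDomain i hi m h⟩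
    rw [killCompl_monomial_mapDomain, ← hm, Finsupp.degree_mapDomain]
    exact monomial_mem_degPiece _ _
  · rw [killCompl_monomial_eq_zero_of_not_subset hi a h]
    exact Submodule.zero_mem _

end Pieces

/-! ### Splitting off a variable; exactness of the Koszul complex of the polynomial ring. -/

section Division

variable {τ K : Type*} [Fintype τ] [DecidableEq τ] [Field K]

/-- Division by the variable `X y`, dropping the monomials that do not contain it. -/
noncomputable def divX (y : τ) : MvPolynomial τ K →ₗ[K] MvPolynomial τ K where
  toFun g := g.divMonomial (Finsupp.single y 1)
  map_add' f g := add_divMonomial _ _ _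
  map_smul' a f := by ext m; simp

/-- The sum of the terms that do not contain the variable `X y`. -/
noncomputable def evX (y : τ) : MvPolynomial τ K →ₗ[K] MvPolynomial τ K :=
  LinearMap.id - mulX y ∘ₗ divX y

lemma coeff_divX (y : τ) (g : MvPolynomial τ K) (m : τ →₀ ℕ) :
    (divX y g).coeff m = g.coeff (Finsupp.single y 1 + m) := coeff_divMonomial _ _ _

lemma divX_X_mul (y : τ) (g : MvPolynomial τ K) : divX y (X y * g) = g :=
  X_mul_divMonomial _ _

lemma divX_X_mul_of_ne {y s : τ} (h : s ≠ y) (g : MvPolynomial τ K) :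
    divX y (X s * g) = X s * divX y g := by
  ext m
  rw [coeff_divX, coeff_X_mul', coeff_X_mul', coeff_divX]
  have : s ∈ (Finsupp.single y 1 + m).support ↔ s ∈ m.support := by
    simp [h.symm]
  rw [if_congr this rfl rfl]
  split_ifs with hs
  · congr 1
    ext t
    by_cases hts : t = s
    · subst hts; simp [h.symm]
    · simp [Finsupp.single_apply, Ne.symm hts]
  · rfl

lemma divX_C (y : τ) (a : K) : divX y (C a) = 0 := by
  ext m
  rw [coeff_divX, coeff_C, if_neg, coeff_zero]
  intro h
  have := DFunLike.congr_fun h y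
  simp at this
  omega

lemma evX_apply (y : τ) (g : MvPolynomial τ K) : evX y g = g - X y * divX y g := rfl

lemma evX_X_mul (y : τ) (g : MvPolynomial τ K) : evX y (X y * g) = 0 := by
  rw [evX_apply, divX_X_mul, sub_self]

lemma evX_X_mul_of_ne {y s : τ} (h : s ≠ y) (g : MvPolynomial τ K) :
    evX y (X s * g) = X s * evX y g := by
  rw [evX_apply, evX_apply, divX_X_mul_of_ne h]; ring

lemma evX_evX (y : τ) (g : MvPolynomial τ K) : evX y (evX y g) = evX y g := by
  rw [evX_apply y g, map_sub, evX_X_mul, sub_zero, evX_apply]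

lemma divX_evX (y : τ) (g : MvPolynomial τ K) : divX y (evX y g) = 0 := by
  rw [evX_apply, map_sub, divX_X_mul, sub_self]

lemma divX_comm {y z : τ} (g : MvPolynomial τ K) : divX y (divX z g) = divX z (divX y g) := by
  ext m
  simp only [coeff_divX]
  congr 1
  abel

lemma divX_mem_degPiece (y : τ) {d : ℤ} {g : MvPolynomial τ K} (hg : g ∈ degPiece τ K d) :
    divX y g ∈ degPiece τ K (d - 1) := by
  intro m hm
  rw [coeff_divX] at hm
  have := hg _ hm
  rw [map_add, Finsupp.degree_single] at this
  push_cast at this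
  omega

lemma evX_mem_degPiece (y : τ) {d : ℤ} {g : MvPolynomial τ K} (hg : g ∈ degPiece τ K d) :
    evX y g ∈ degPiece τ K d :=
  Submodule.sub_mem _ hg (X_mul_mem_degPiece y (divX_mem_degPiece y hg))

lemma rename_killCompl {σ : Type*} {i : σ → τ} (hi : Function.Injective i) {y : τ}
    (hy : Set.range i = {y}ᶜ) (g : MvPolynomial τ K) :
    rename i (killCompl hi g) = evX y g := by
  induction g using MvPolynomial.induction_on with
  | C a => rw [killCompl_C, rename_C, evX_apply, divX_C, mul_zero, sub_zero]
  | add f g hf hg => simp only [map_add, hf, hg]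
  | mul_X g s hg =>
    rw [map_mul, map_mul, hg, mul_comm g, mul_comm]
    by_cases hs : s = y
    · subst hs
      rw [evX_X_mul, killCompl, aeval_X, dif_neg (by simp [hy]), map_zero, zero_mul]
    · rw [evX_X_mul_of_ne hs]
      have : s ∈ Set.range i := by simp [hy, hs]
      obtain ⟨t, rfl⟩ := this
      rw [← rename_X, killCompl_rename_app]

lemma wedge_mem (N : Submodule K (MvPolynomial τ K)) (y : τ) {p : ℕ}
    {g : (τ → K) [⋀^Fin p]→ₗ[K] MvPolynomial τ K} (hg : ∀ v, g v ∈ N) (v : Fin (p + 1) → τ → K) :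
    wedge (form y) g v ∈ N := by
  rw [wedge_apply]
  refine Submodule.sum_mem _ fun i _ => ?_
  have h := Submodule.smul_mem N (form y (v i)) (hg (i.removeNth v))
  rcases neg_one_pow_eq_or ℤ (i : ℕ) with h1 | h1
  · rw [h1, one_smul]; exact h
  · rw [h1, neg_smul, one_smul]; exact Submodule.neg_mem _ h

/-- On a cycle, the failure of `T` to be a chain map is its commutator with multiplication by `X y`.
For `T = divX y` this commutator is `evX y`, so the right side becomes a cycle minus its truncation.
-/
lemma koszulD_wedge_comp (y : τ) (T : MvPolynomial τ K →ₗ[K] MvPolynomial τ K)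
    (hT : ∀ s ≠ y, ∀ g, T (X s * g) = X s * T g) {p : ℕ}
    (f : (τ → K) [⋀^Fin (p + 1)]→ₗ[K] MvPolynomial τ K) (hf : koszulD τ K _ p f = 0) :
    koszulD τ K _ (p + 1) (wedge (form y) (T.compAlternatingMap f)) =
      (mulX y ∘ₗ T).compAlternatingMap f +
      (T ∘ₗ mulX y - mulX y ∘ₗ T).compAlternatingMap (wedge (form y) (f.curryLeft (e y))) := by
  have h := koszulD_homotopy y T hT f
  rw [hf] at h
  have h2 : koszulD τ K _ p (T.compAlternatingMap f) =
      -(T ∘ₗ mulX y - mulX y ∘ₗ T).compAlternatingMap (f.curryLeft (e y)) := by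
    rw [eq_neg_iff_add_eq_zero, ← h]
    ext v : 1
    simp
  rw [koszulD_wedge, h2, compAlternatingMap_wedge]
  have h3 : ∀ g : (τ → K) [⋀^Fin p]→ₗ[K] MvPolynomial τ K,
      wedge (form y) (-g) = -wedge (form y) g := fun g => by
    rw [eq_neg_iff_add_eq_zero, ← wedge_add, neg_add_cancel, wedge_zero]
  rw [h3, sub_neg_eq_add]
  rfl

/-- Since `proj y` kills `e y`, the summand of `y` drops out of the boundary. The correction term
vanishes for `T = evX y`, so truncation is a chain map; for `T = linX y` it produces the
contraction. -/
lemma koszulD_comp_proj (y : τ) (T : MvPolynomial τ K →ₗ[K] MvPolynomial τ K)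
    (hT : ∀ s ≠ y, ∀ g, T (X s * g) = X s * T g) {p : ℕ}
    (f : (τ → K) [⋀^Fin (p + 1)]→ₗ[K] MvPolynomial τ K) :
    koszulD τ K _ p ((T.compAlternatingMap f).compLinearMap (proj y)) =
      (T.compAlternatingMap (koszulD τ K _ p f) -
        (T ∘ₗ mulX y).compAlternatingMap (f.curryLeft (e y))).compLinearMap (proj y) := by
  rw [koszulD_homotopy y T hT]
  ext v : 1
  simp only [AlternatingMap.compLinearMap_apply, AlternatingMap.sub_apply,
    AlternatingMap.add_apply, LinearMap.compAlternatingMap_apply, koszulD_apply, smul_eq_mul]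
  rw [← Finset.add_sum_erase _ _ (Finset.mem_univ y), ← Finset.add_sum_erase _ _ (Finset.mem_univ y)]
  have h1 : ∀ s, (fun i => proj y ((Matrix.vecCons (e s) v : Fin (p + 1) → τ → K) i)) =
      Matrix.vecCons (proj y (e s)) (fun i => proj y (v i)) := fun s => by
    ext i : 1
    refine Fin.cases ?_ (fun j => ?_) i <;> simp
  have h0 : f (Matrix.vecCons (0 : τ → K) (fun i => proj y (v i))) = 0 :=
    f.map_coord_zero 0 (by simp)
  have h2 : ∀ s ∈ Finset.univ.erase y,
      X s * T (f fun i => proj y ((Matrix.vecCons (e s) v : Fin (p + 1) → τ → K) i)) =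
      X s * T (f (Matrix.vecCons (e s) (fun i => proj y (v i)))) := fun s hs => by
    rw [h1, proj_e_of_ne (Finset.ne_of_mem_erase hs)]
  rw [Finset.sum_congr rfl h2, h1, proj_e_self, h0]
  simp
  ring

lemma koszulD_wedge_divX_zero (y : τ) (f : (τ → K) [⋀^Fin 0]→ₗ[K] MvPolynomial τ K) :
    koszulD τ K _ 0 (wedge (form y) ((divX y).compAlternatingMap f)) =
      f - ((evX y).compAlternatingMap f).compLinearMap (proj y) := by
  rw [koszulD_wedge_zero, compLinearMap_proj_zero]
  ext v : 1
  simp only [LinearMap.compAlternatingMap_apply, AlternatingMap.sub_apply, evX_apply,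
    LinearMap.mulLeft_apply, sub_sub_cancel]

lemma koszulD_wedge_divX_succ (y : τ) {p : ℕ}
    (f : (τ → K) [⋀^Fin (p + 1)]→ₗ[K] MvPolynomial τ K) (hf : koszulD τ K _ p f = 0) :
    koszulD τ K _ (p + 1) (wedge (form y) ((divX y).compAlternatingMap f)) =
      f - ((evX y).compAlternatingMap f).compLinearMap (proj y) := by
  rw [koszulD_wedge_comp y _ (fun s hs g => divX_X_mul_of_ne hs g) f hf, compLinearMap_proj,
    AlternatingMap.curryLeft_compAlternatingMap, ← compAlternatingMap_wedge]
  ext v : 1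
  simp only [LinearMap.compAlternatingMap_apply, AlternatingMap.sub_apply, evX_apply,
    LinearMap.mulLeft_apply, AlternatingMap.add_apply, LinearMap.comp_apply,
    LinearMap.sub_apply, divX_X_mul]
  ring

/-- A cycle is homologous to its part without `X y` and `e_y`. -/
lemma exists_koszulD_eq_sub (y : τ) {p : ℕ} {d : ℤ}
    {f : (τ → K) [⋀^Fin p]→ₗ[K] MvPolynomial τ K} (hf : f ∈ koszulCycles τ K _ p)
    (hd : ∀ v, f v ∈ degPiece τ K d) :
    ∃ k : (τ → K) [⋀^Fin (p + 1)]→ₗ[K] MvPolynomial τ K, (∀ v, k v ∈ degPiece τ K (d - 1)) ∧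
      koszulD τ K _ p k = f - ((evX y).compAlternatingMap f).compLinearMap (proj y) := by
  have hdiv : ∀ v, (divX y).compAlternatingMap f v ∈ degPiece τ K (d - 1) := fun v =>
    divX_mem_degPiece y (hd v)
  refine ⟨wedge (form y) ((divX y).compAlternatingMap f),
    fun v => wedge_mem (degPiece τ K (d - 1)) y hdiv v, ?_⟩
  cases p with
  | zero => exact koszulD_wedge_divX_zero y f
  | succ p => exact koszulD_wedge_divX_succ y f hf

lemma evX_comp_proj_mem_koszulCycles (y : τ) {p : ℕ}
    {f : (τ → K) [⋀^Fin p]→ₗ[K] MvPolynomial τ K} (hf : f ∈ koszulCycles τ K _ p) :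
    ((evX y).compAlternatingMap f).compLinearMap (proj y) ∈ koszulCycles τ K _ p := by
  cases p with
  | zero => trivial
  | succ p =>
    change koszulD τ K _ p _ = 0
    have hf' : koszulD τ K _ p f = 0 := hf
    rw [koszulD_comp_proj y _ (fun s hs g => evX_X_mul_of_ne hs g), hf']
    ext v : 1
    simp [evX_X_mul]

lemma exists_koszulD_eq_sub_of_finset (s : Finset τ) {p : ℕ} {d : ℤ}
    {f : (τ → K) [⋀^Fin p]→ₗ[K] MvPolynomial τ K} (hf : f ∈ koszulCycles τ K _ p)
    (hd : ∀ v, f v ∈ degPiece τ K d) :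
    ∃ k : (τ → K) [⋀^Fin (p + 1)]→ₗ[K] MvPolynomial τ K, (∀ v, k v ∈ degPiece τ K (d - 1)) ∧
      ∃ g : (τ → K) [⋀^Fin p]→ₗ[K] MvPolynomial τ K, koszulD τ K _ p k = f - g ∧
        g ∈ koszulCycles τ K _ p ∧ (∀ v, g v ∈ degPiece τ K d) ∧
        (∀ z ∈ s, ∀ v, divX z (g v) = 0) ∧ ∀ z ∈ s, ∀ v i, v i = e z → g v = 0 := by
  induction s using Finset.induction_on with
  | empty => exact ⟨0, by simp, f, by simp, hf, hd, by simp, by simp⟩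
  | insert y s hy ih =>
    obtain ⟨k, hk, g, hkg, hg, hgd, hg1, hg2⟩ := ih
    obtain ⟨k', hk', h⟩ := exists_koszulD_eq_sub y hg hgd
    refine ⟨k + k', fun v => Submodule.add_mem _ (hk v) (hk' v), _,
      by rw [map_add, hkg, h, sub_add_sub_cancel], evX_comp_proj_mem_koszulCycles y hg,
      fun v => evX_mem_degPiece y (hgd _), ?_, ?_⟩
    · intro z hz v
      simp only [AlternatingMap.compLinearMap_apply, LinearMap.compAlternatingMap_apply]
      by_cases hzy : z = y
      · rw [hzy, divX_evX]
      · rw [evX_apply, map_sub, divX_X_mul_of_ne (Ne.symm hzy), divX_comm,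
          hg1 z (Finset.mem_of_mem_insert_of_ne hz hzy)]
        simp
    · intro z hz v i hv
      simp only [AlternatingMap.compLinearMap_apply, LinearMap.compAlternatingMap_apply]
      by_cases hzy : z = y
      · rw [g.map_coord_zero i (by rw [hv, hzy, proj_e_self]), map_zero]
      · rw [hg2 z (Finset.mem_of_mem_insert_of_ne hz hzy) _ i (by rw [hv, proj_e_of_ne hzy]),
          map_zero]

/-- The Koszul complex of the polynomial ring is exact except in bidegree `(0, 0)`. -/
lemma koszul_exact {p : ℕ} {d : ℤ} (hpd : p ≠ 0 ∨ d ≠ 0)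
    {f : (τ → K) [⋀^Fin p]→ₗ[K] MvPolynomial τ K} (hf : f ∈ koszulCycles τ K _ p)
    (hd : ∀ v, f v ∈ degPiece τ K d) :
    ∃ k : (τ → K) [⋀^Fin (p + 1)]→ₗ[K] MvPolynomial τ K, (∀ v, k v ∈ degPiece τ K (d - 1)) ∧
      koszulD τ K _ p k = f := by
  obtain ⟨k, hk, g, hkg, -, hgd, hg1, hg2⟩ := exists_koszulD_eq_sub_of_finset Finset.univ hf hd
  refine ⟨k, hk, ?_⟩
  suffices g = 0 by rw [hkg, this, sub_zero]
  -- The cycle `g` contains no variable and vanishes as soon as one argument is a basis vector, so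
  -- it could survive only as a constant in homological degree `0`.
  cases p with
  | zero =>
    have hd0 : d ≠ 0 := by simpa using hpd
    ext v m
    rw [AlternatingMap.zero_apply, coeff_zero]
    by_contra hm
    have hmd := hgd v m hm
    have hm0 : m ≠ 0 := by
      rintro rfl
      simp at hmd
      exact hd0 hmd.symm
    obtain ⟨z, hz⟩ := Finsupp.ne_iff.1 hm0
    have h := congrArg (coeff (m - Finsupp.single z 1)) (hg1 z (Finset.mem_univ _) v)
    rw [coeff_divX, add_tsub_cancel_of_le, coeff_zero] at h
    · exact hm h
    · rw [Finsupp.single_le_iff]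
      exact Nat.one_le_iff_ne_zero.2 hz
  | succ p =>
    refine Module.Basis.ext_alternating (Pi.basisFun K τ) fun v _ => ?_
    rw [AlternatingMap.zero_apply]
    exact hg2 (v 0) (Finset.mem_univ _) _ 0 (by simp [e])

end Division

end Koszul

namespace Koszul

/-! ### Koszul homology under the adjunction of one variable. -/

section Transport

variable {σ τ K : Type*} [Fintype σ] [DecidableEq σ] [Fintype τ] [DecidableEq τ] [Field K]

/-- The homogeneous elements of degree `d` of an ideal. -/
noncomputable def piece (J : Ideal (MvPolynomial τ K)) (d : ℤ) : Submodule K (MvPolynomial τ K) :=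
  J.restrictScalars K ⊓ degPiece τ K d

/-- `Tor_p(K, J)` is nonzero in degree `d + p`. -/
def HasHomology (J : Ideal (MvPolynomial τ K)) (p : ℕ) (d : ℤ) : Prop :=
  ∃ f ∈ koszulCycles τ K (MvPolynomial τ K) p, (∀ v, f v ∈ piece J d) ∧
    ∀ g : (τ → K) [⋀^Fin (p + 1)]→ₗ[K] MvPolynomial τ K, (∀ v, g v ∈ piece J (d - 1)) →
      koszulD τ K _ p g ≠ f

/-- The inclusion `K^σ → K^τ` of coordinate spaces. -/
noncomputable def vecIncl (i : σ → τ) : (σ → K) →ₗ[K] (τ → K) :=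
  Function.ExtendByZero.linearMap K i

/-- The projection `K^τ → K^σ` of coordinate spaces. -/
def vecProj (i : σ → τ) : (τ → K) →ₗ[K] (σ → K) := LinearMap.funLeft K K i

lemma vecIncl_e {i : σ → τ} (hi : Function.Injective i) (s : σ) :
    vecIncl i (e s : σ → K) = e (i s) := by
  ext t
  simp only [vecIncl, Function.ExtendByZero.linearMap_apply]
  by_cases h : ∃ s', i s' = t
  · obtain ⟨s', rfl⟩ := h
    rw [hi.extend_apply]
    simp [e, Pi.single_apply, hi.eq_iff]
  · rw [Function.extend_apply' _ _ _ h]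
    simp only [e, Pi.zero_apply]
    rw [Pi.single_apply, if_neg]
    rintro rfl
    exact h ⟨s, rfl⟩

lemma vecProj_e {i : σ → τ} (hi : Function.Injective i) (s : σ) :
    vecProj i (e (i s) : τ → K) = e s := by
  ext t
  simp [vecProj, LinearMap.funLeft_apply, e, Pi.single_apply, hi.eq_iff]

lemma vecProj_e_of_notMem {i : σ → τ} {t : τ} (ht : t ∉ Set.range i) :
    vecProj i (e t : τ → K) = 0 := by
  ext s
  simp only [vecProj, LinearMap.funLeft_apply, e, Pi.single_apply, Pi.zero_apply]
  rw [if_neg]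
  rintro rfl
  exact ht ⟨s, rfl⟩

lemma vecIncl_vecProj {i : σ → τ} (hi : Function.Injective i) {y : τ} (hy : Set.range i = {y}ᶜ)
    (v : τ → K) : vecIncl i (vecProj i v) = proj y v := by
  ext t
  simp only [vecIncl, Function.ExtendByZero.linearMap_apply, vecProj]
  by_cases h : t = y
  · subst h
    rw [Function.extend_apply']
    · simp [proj, e]
    · intro h
      have : t ∈ Set.range i := h
      simp [hy] at this
  · have : t ∈ Set.range i := by simp [hy, h]
    obtain ⟨s, rfl⟩ := this
    rw [hi.extend_apply]
    simp [proj, e, LinearMap.funLeft_apply, h]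

/-- Extension of Koszul chains along an inclusion of variables. -/
noncomputable def extendChain (i : σ → τ) {p : ℕ} (f : (σ → K) [⋀^Fin p]→ₗ[K] MvPolynomial σ K) :
    (τ → K) [⋀^Fin p]→ₗ[K] MvPolynomial τ K :=
  ((rename i).toLinearMap.compAlternatingMap f).compLinearMap (vecProj i)

/-- Restriction of Koszul chains along an inclusion of variables. -/
noncomputable def restrictChain {i : σ → τ} (hi : Function.Injective i) {p : ℕ}
    (f : (τ → K) [⋀^Fin p]→ₗ[K] MvPolynomial τ K) : (σ → K) [⋀^Fin p]→ₗ[K] MvPolynomial σ K :=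
  ((killCompl hi).toLinearMap.compAlternatingMap f).compLinearMap (vecIncl i)

lemma extendChain_apply (i : σ → τ) {p : ℕ} (f : (σ → K) [⋀^Fin p]→ₗ[K] MvPolynomial σ K)
    (v : Fin p → τ → K) : extendChain i f v = rename i (f fun j => vecProj i (v j)) := rfl

lemma restrictChain_apply {i : σ → τ} (hi : Function.Injective i) {p : ℕ}
    (f : (τ → K) [⋀^Fin p]→ₗ[K] MvPolynomial τ K) (v : Fin p → σ → K) :
    restrictChain hi f v = killCompl hi (f fun j => vecIncl i (v j)) := rfl

lemma map_vecCons {V W : Type*} (u : V → W) {p : ℕ} (x : V) (v : Fin p → V) :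
    (fun j => u ((Matrix.vecCons x v : Fin (p + 1) → V) j)) =
      Matrix.vecCons (u x) (fun j => u (v j)) := by
  ext j : 1
  refine Fin.cases ?_ (fun j => ?_) j <;> simp

lemma koszulD_extendChain {i : σ → τ} (hi : Function.Injective i) {p : ℕ}
    (f : (σ → K) [⋀^Fin (p + 1)]→ₗ[K] MvPolynomial σ K) :
    koszulD τ K _ p (extendChain i f) = extendChain i (koszulD σ K _ p f) := by
  ext v : 1
  rw [extendChain_apply, koszulD_apply, koszulD_apply, map_sum]
  symm
  refine Fintype.sum_of_injective i hi _ _ (fun t ht => ?_) (fun s => ?_)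
  · rw [extendChain_apply, map_vecCons, vecProj_e_of_notMem ht, f.map_coord_zero 0 (by simp)]
    simp
  · rw [extendChain_apply, map_vecCons, vecProj_e hi]
    simp

lemma killCompl_X_of_notMem {i : σ → τ} (hi : Function.Injective i) {t : τ}
    (ht : t ∉ Set.range i) : killCompl hi (X t : MvPolynomial τ K) = 0 := by
  rw [killCompl, aeval_X, dif_neg ht]

lemma killCompl_X {i : σ → τ} (hi : Function.Injective i) (s : σ) :
    killCompl hi (X (i s) : MvPolynomial τ K) = X s := by
  rw [← rename_X, killCompl_rename_app]

lemma koszulD_restrictChain {i : σ → τ} (hi : Function.Injective i) {p : ℕ}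
    (f : (τ → K) [⋀^Fin (p + 1)]→ₗ[K] MvPolynomial τ K) :
    koszulD σ K _ p (restrictChain hi f) = restrictChain hi (koszulD τ K _ p f) := by
  ext v : 1
  rw [restrictChain_apply, koszulD_apply, koszulD_apply, map_sum]
  refine Fintype.sum_of_injective i hi _ _ (fun t ht => ?_) (fun s => ?_)
  · rw [smul_eq_mul, map_mul, killCompl_X_of_notMem hi ht, zero_mul]
  · rw [restrictChain_apply, map_vecCons, vecIncl_e hi, smul_eq_mul, smul_eq_mul, map_mul,
      killCompl_X]

lemma extendChain_mem_koszulCycles {i : σ → τ} (hi : Function.Injective i) {p : ℕ}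
    {f : (σ → K) [⋀^Fin p]→ₗ[K] MvPolynomial σ K} (hf : f ∈ koszulCycles σ K _ p) :
    extendChain i f ∈ koszulCycles τ K _ p := by
  cases p with
  | zero => trivial
  | succ p =>
    have hf' : koszulD σ K _ p f = 0 := hf
    change koszulD τ K _ p _ = 0
    rw [koszulD_extendChain hi, hf']
    ext v : 1
    simp [extendChain_apply]

lemma restrictChain_mem_koszulCycles {i : σ → τ} (hi : Function.Injective i) {p : ℕ}
    {f : (τ → K) [⋀^Fin p]→ₗ[K] MvPolynomial τ K} (hf : f ∈ koszulCycles τ K _ p) :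
    restrictChain hi f ∈ koszulCycles σ K _ p := by
  cases p with
  | zero => trivial
  | succ p =>
    have hf' : koszulD τ K _ p f = 0 := hf
    change koszulD σ K _ p _ = 0
    rw [koszulD_restrictChain hi, hf']
    ext v : 1
    simp [restrictChain_apply]

lemma restrictChain_extendChain {i : σ → τ} (hi : Function.Injective i) {p : ℕ}
    (f : (σ → K) [⋀^Fin p]→ₗ[K] MvPolynomial σ K) :
    restrictChain hi (extendChain i f) = f := by
  ext v : 1
  rw [restrictChain_apply, extendChain_apply, killCompl_rename_app]
  congr 1
  ext j s
  simp [vecProj, vecIncl, LinearMap.funLeft_apply, hi.extend_apply]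

/-- The ideals `J` and `J'` are related by an inclusion of variables which is split by setting
the other variables to zero. -/
structure IsRetract {i : σ → τ} (hi : Function.Injective i) (J : Ideal (MvPolynomial σ K))
    (J' : Ideal (MvPolynomial τ K)) : Prop where
  rename_mem : ∀ g ∈ J, rename i g ∈ J'
  killCompl_mem : ∀ g ∈ J', killCompl hi g ∈ J

variable {J : Ideal (MvPolynomial σ K)} {J' : Ideal (MvPolynomial τ K)}

lemma IsRetract.extendChain_mem {i : σ → τ} {hi : Function.Injective i} (h : IsRetract hi J J')
    {p : ℕ} {d : ℤ} {f : (σ → K) [⋀^Fin p]→ₗ[K] MvPolynomial σ K} (hf : ∀ v, f v ∈ piece J d)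
    (v : Fin p → τ → K) : extendChain i f v ∈ piece J' d :=
  ⟨h.rename_mem _ (hf _).1, rename_mem_degPiece _ (hf _).2⟩

lemma IsRetract.restrictChain_mem {i : σ → τ} {hi : Function.Injective i}
    (h : IsRetract hi J J') {p : ℕ} {d : ℤ} {f : (τ → K) [⋀^Fin p]→ₗ[K] MvPolynomial τ K}
    (hf : ∀ v, f v ∈ piece J' d) (v : Fin p → σ → K) : restrictChain hi f v ∈ piece J d :=
  ⟨h.killCompl_mem _ (hf _).1, killCompl_mem_degPiece _ (hf _).2⟩

/-- Extension and restriction are chain maps, and restriction undoes extension, so the homology of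
`J` is a direct summand of that of `J'`. -/
lemma IsRetract.hasHomology {i : σ → τ} {hi : Function.Injective i} (h : IsRetract hi J J')
    {p : ℕ} {d : ℤ} (hJ : HasHomology J p d) : HasHomology J' p d := by
  obtain ⟨f, hf, hfd, hfb⟩ := hJ
  refine ⟨extendChain i f, extendChain_mem_koszulCycles hi hf, h.extendChain_mem hfd,
    fun g hg hgf => hfb (restrictChain hi g) (h.restrictChain_mem hg) ?_⟩
  rw [koszulD_restrictChain, hgf, restrictChain_extendChain]

/-- A cycle free of the variable `y` is a boundary if the corresponding homology vanishes. -/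
lemma IsRetract.exists_koszulD_eq {i : σ → τ} {hi : Function.Injective i}
    (h : IsRetract hi J J') {y : τ} (hy : Set.range i = {y}ᶜ) {p : ℕ} {d : ℤ}
    (hJ : ¬ HasHomology J p d) {a : (τ → K) [⋀^Fin p]→ₗ[K] MvPolynomial τ K}
    (ha : a ∈ koszulCycles τ K _ p) (had : ∀ v, a v ∈ piece J' d)
    (hay : ((evX y).compAlternatingMap a).compLinearMap (proj y) = a) :
    ∃ b : (τ → K) [⋀^Fin (p + 1)]→ₗ[K] MvPolynomial τ K, (∀ v, b v ∈ piece J' (d - 1)) ∧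
      koszulD τ K _ p b = a := by
  by_contra! hb
  refine hJ ⟨restrictChain hi a, restrictChain_mem_koszulCycles hi ha, h.restrictChain_mem had,
    fun g hg hga => hb (extendChain i g) (h.extendChain_mem hg) ?_⟩
  rw [koszulD_extendChain hi, hga]
  -- Extending a restricted chain gives its truncation by `evX y` and `proj y`, which fixes `a`.
  conv_rhs => rw [← hay]
  ext v : 1
  rw [extendChain_apply, restrictChain_apply, rename_killCompl hi hy]
  simp only [vecIncl_vecProj hi hy]
  rfl

/-- The part of a polynomial of degree one in the variable `y`, divided by `y`. -/
noncomputable def linX (y : τ) : MvPolynomial τ K →ₗ[K] MvPolynomial τ K := evX y ∘ₗ divX y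

/-- The part of a polynomial of degree at least two in the variable `y`, divided by `y`. -/
noncomputable def shiftX (y : τ) : MvPolynomial τ K →ₗ[K] MvPolynomial τ K := divX y - linX y

lemma koszulD_homotopy_zero (y : τ) (f : (τ → K) [⋀^Fin 0]→ₗ[K] MvPolynomial τ K) :
    koszulD τ K _ 0 (wedge (form y) ((shiftX y).compAlternatingMap f)) =
      f - (evX y).compAlternatingMap f - (mulX y ∘ₗ linX y).compAlternatingMap f := by
  rw [koszulD_wedge_zero]
  ext v : 1
  simp only [LinearMap.compAlternatingMap_apply, AlternatingMap.sub_apply, evX_apply, shiftX,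
    LinearMap.mulLeft_apply, LinearMap.sub_apply, LinearMap.comp_apply, sub_sub_cancel, mul_sub]

lemma linX_X_mul_of_ne {y s : τ} (h : s ≠ y) (g : MvPolynomial τ K) :
    linX y (X s * g) = X s * linX y g := by
  simp only [linX, LinearMap.comp_apply, divX_X_mul_of_ne h, evX_X_mul_of_ne h]

lemma koszulD_homotopy_succ (y : τ) {p : ℕ} (f : (τ → K) [⋀^Fin (p + 1)]→ₗ[K] MvPolynomial τ K)
    (hf : koszulD τ K _ p f = 0) :
    koszulD τ K _ (p + 1) (wedge (form y) ((shiftX y).compAlternatingMap f)) =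
      f - ((evX y).compAlternatingMap f).compLinearMap (proj y) -
        wedge (form y) ((evX y).compAlternatingMap (f.curryLeft (e y))) -
        (mulX y).compAlternatingMap
          (((linX y).compAlternatingMap f).compLinearMap (proj y)) := by
  rw [koszulD_wedge_comp y _ (fun s hs g => by
    rw [shiftX, LinearMap.sub_apply, LinearMap.sub_apply, divX_X_mul_of_ne hs, linX_X_mul_of_ne hs,
      mul_sub]) f hf, compLinearMap_proj, compLinearMap_proj,
      AlternatingMap.curryLeft_compAlternatingMap, AlternatingMap.curryLeft_compAlternatingMap,
      ← compAlternatingMap_wedge, ← compAlternatingMap_wedge]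
  ext v : 1
  simp only [LinearMap.compAlternatingMap_apply, AlternatingMap.sub_apply, evX_apply, linX, shiftX,
      LinearMap.mulLeft_apply, AlternatingMap.add_apply, LinearMap.comp_apply,
      LinearMap.sub_apply, divX_X_mul]
  ring

lemma linX_mem_degPiece (y : τ) {d : ℤ} {g : MvPolynomial τ K} (hg : g ∈ degPiece τ K d) :
    linX y g ∈ degPiece τ K (d - 1) := evX_mem_degPiece y (divX_mem_degPiece y hg)

lemma evX_mem_piece {y : τ} (hy : X y ∈ J') {d : ℤ} {g : MvPolynomial τ K}
    (hg : g ∈ piece J' d) : evX y g ∈ piece J' d :=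
  ⟨J'.sub_mem hg.1 (J'.mul_mem_right _ hy), evX_mem_degPiece y hg.2⟩

/-- The value is `X y` times the second quotient by `y`, hence in `J'` for any `g`. With `divX`
instead, dividing an element of `J'` by `y` could leave `J'`; the linear part is therefore treated
separately. -/
lemma shiftX_mem_piece {y : τ} (hy : X y ∈ J') {d : ℤ} {g : MvPolynomial τ K}
    (hg : g ∈ degPiece τ K d) : shiftX y g ∈ piece J' (d - 1) := by
  refine ⟨?_, Submodule.sub_mem _ (divX_mem_degPiece y hg) (linX_mem_degPiece y hg)⟩
  have : shiftX y g = X y * divX y (divX y g) := by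
    simp only [shiftX, LinearMap.sub_apply, linX, LinearMap.comp_apply, evX_apply, sub_sub_cancel]
  rw [this]
  exact J'.mul_mem_right _ hy

lemma koszulD_mulX (y : τ) {p : ℕ} (k : (τ → K) [⋀^Fin (p + 1)]→ₗ[K] MvPolynomial τ K) :
    koszulD τ K _ p ((mulX y).compAlternatingMap k) =
      (mulX y).compAlternatingMap (koszulD τ K _ p k) := by
  ext v : 1
  simp only [koszulD_apply, LinearMap.compAlternatingMap_apply, LinearMap.mulLeft_apply,
    Finset.mul_sum, smul_eq_mul]
  exact Finset.sum_congr rfl fun s _ => by ring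

/-- A cycle with values in `y S` is the boundary of a chain with values in `y S`, except in the
degree of the generator `y`. -/
lemma exists_koszulD_eq_mulX {y : τ} (hy : X y ∈ J') {p : ℕ} {d : ℤ} (hd : p ≠ 0 ∨ d ≠ 1)
    {f : (τ → K) [⋀^Fin p]→ₗ[K] MvPolynomial τ K} (hf : f ∈ koszulCycles τ K _ p)
    (hfd : ∀ v, f v ∈ degPiece τ K (d - 1)) :
    ∃ b : (τ → K) [⋀^Fin (p + 1)]→ₗ[K] MvPolynomial τ K, (∀ v, b v ∈ piece J' (d - 1)) ∧
      koszulD τ K _ p b = (mulX y).compAlternatingMap f := by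
  obtain ⟨k, hk, hkf⟩ := koszul_exact (hd.imp_right fun h => sub_ne_zero.2 h) hf hfd
  exact ⟨(mulX y).compAlternatingMap k,
    fun v => ⟨J'.mul_mem_right _ hy, X_mul_mem_degPiece y (hk v)⟩, by rw [koszulD_mulX, hkf]⟩

lemma evX_comp_proj_idem (y : τ) {p : ℕ} (f : (τ → K) [⋀^Fin p]→ₗ[K] MvPolynomial τ K) :
    ((evX y).compAlternatingMap
      (((evX y).compAlternatingMap f).compLinearMap (proj y))).compLinearMap (proj y) =
    ((evX y).compAlternatingMap f).compLinearMap (proj y) := by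
  have hp : ∀ x : τ → K, proj y (proj y x) = proj y x := fun x => by simp [proj, e]
  ext v : 1
  simp only [AlternatingMap.compLinearMap_apply, LinearMap.compAlternatingMap_apply, hp, evX_evX]

/-- The coefficient of `e_y` free of `y`, for a cycle. -/
noncomputable def contraction (y : τ) {p : ℕ} (f : (τ → K) [⋀^Fin (p + 1)]→ₗ[K] MvPolynomial τ K) :
    (τ → K) [⋀^Fin p]→ₗ[K] MvPolynomial τ K :=
  (evX y).compAlternatingMap (f.curryLeft (e y))

lemma contraction_mem_koszulCycles (y : τ) {p : ℕ}
    {f : (τ → K) [⋀^Fin (p + 1)]→ₗ[K] MvPolynomial τ K} (hf : koszulD τ K _ p f = 0) :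
    contraction y f ∈ koszulCycles τ K _ p := by
  cases p with
  | zero => trivial
  | succ p =>
    change koszulD τ K _ p _ = 0
    have h := koszulD_homotopy y (evX y) (fun s hs g => evX_X_mul_of_ne hs g) (f.curryLeft (e y))
    have h1 : koszulD τ K _ p (f.curryLeft (e y)) = 0 := by
      rw [← neg_eq_zero, ← curryLeft_koszulD, hf]
      rfl
    rw [h1, AlternatingMap.curryLeft_same] at h
    have h2 : koszulD τ K _ p ((evX y).compAlternatingMap (f.curryLeft (e y))) = 0 := by
      ext v : 1
      have := congrArg (fun F => F v) h
      simpa using this.symm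
    exact h2

lemma contraction_comp_proj (y : τ) {p : ℕ}
    (f : (τ → K) [⋀^Fin (p + 1)]→ₗ[K] MvPolynomial τ K) :
    (contraction y f).compLinearMap (proj y) = contraction y f := by
  cases p with
  | zero => exact compLinearMap_proj_zero _ _
  | succ p =>
    refine compLinearMap_proj_of_curryLeft _ _ ?_
    rw [contraction, AlternatingMap.curryLeft_compAlternatingMap, AlternatingMap.curryLeft_same]
    ext v : 1
    simp

lemma evX_contraction (y : τ) {p : ℕ} (f : (τ → K) [⋀^Fin (p + 1)]→ₗ[K] MvPolynomial τ K) :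
    ((evX y).compAlternatingMap (contraction y f)).compLinearMap (proj y) = contraction y f := by
  have : (evX y).compAlternatingMap (contraction y f) = contraction y f := by
    ext v : 1
    exact evX_evX y _
  rw [this, contraction_comp_proj]

/-- These are the terms of the cycle condition that are linear in `y` and free of `e y`.
Consequently a chain bounding the contraction completes the linear part to a cycle. -/
lemma koszulD_linX (y : τ) {p : ℕ} {f : (τ → K) [⋀^Fin (p + 1)]→ₗ[K] MvPolynomial τ K}
    (hf : koszulD τ K _ p f = 0) :
    koszulD τ K _ p (((linX y).compAlternatingMap f).compLinearMap (proj y)) =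
      -contraction y f := by
  rw [koszulD_comp_proj y _ (fun s hs g => linX_X_mul_of_ne hs g), hf, ← contraction_comp_proj]
  ext v : 1
  simp only [AlternatingMap.compLinearMap_apply, AlternatingMap.sub_apply, linX, contraction,
    LinearMap.compAlternatingMap_apply, LinearMap.comp_apply, LinearMap.mulLeft_apply, divX_X_mul,
    AlternatingMap.zero_apply, map_zero, zero_sub, AlternatingMap.neg_apply]

/-- In homological degree `0` there is no contraction term. The value `d = 1` is excluded because
the generator `y` itself is not a boundary there. -/
lemma exists_koszulD_eq_zero {y : τ} (hyJ : X y ∈ J') {d : ℤ} (hd : d ≠ 1)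
    {f : (τ → K) [⋀^Fin 0]→ₗ[K] MvPolynomial τ K} (hfd : ∀ v, f v ∈ piece J' d)
    {b₀ : (τ → K) [⋀^Fin 1]→ₗ[K] MvPolynomial τ K} (hb₀ : ∀ v, b₀ v ∈ piece J' (d - 1))
    (hb₀' : koszulD τ K _ 0 b₀ = ((evX y).compAlternatingMap f).compLinearMap (proj y)) :
    ∃ b : (τ → K) [⋀^Fin 1]→ₗ[K] MvPolynomial τ K, (∀ v, b v ∈ piece J' (d - 1)) ∧
      koszulD τ K _ 0 b = f := by
  have hT : ∀ v, (shiftX y).compAlternatingMap f v ∈ piece J' (d - 1) := fun v =>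
    shiftX_mem_piece hyJ (hfd v).2
  have hg : ∀ v, (linX y).compAlternatingMap f v ∈ degPiece τ K (d - 1) := fun v =>
    linX_mem_degPiece y (hfd v).2
  obtain ⟨b, hb, hb'⟩ := exists_koszulD_eq_mulX (J' := J') hyJ (Or.inr hd) (p := 0)
    (f := (linX y).compAlternatingMap f) Submodule.mem_top hg
  refine ⟨wedge (form y) ((shiftX y).compAlternatingMap f) + b₀ + b,
    fun v => Submodule.add_mem _ (Submodule.add_mem _ (wedge_mem (piece J' (d - 1)) y hT v)
      (hb₀ v)) (hb v), ?_⟩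
  rw [map_add, map_add, koszulD_homotopy_zero, hb', hb₀', compLinearMap_proj_zero]
  ext v : 1
  simp only [AlternatingMap.add_apply, AlternatingMap.sub_apply,
    LinearMap.compAlternatingMap_apply, LinearMap.comp_apply]
  ring

/-- `koszulD_homotopy_succ` leaves three pieces of `f`. The piece free of `y` is bounded by `b₀`. Up
to the boundary of `wedge (form y) b₁`, the contraction piece equals `X y` times `b₁`. Together with
the linear piece this is `X y` times a cycle over the full ring, so `exists_koszulD_eq_mulX` bounds
it. -/
lemma exists_koszulD_eq_succ {y : τ} (hyJ : X y ∈ J') {p : ℕ} {d : ℤ}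
    {f : (τ → K) [⋀^Fin (p + 1)]→ₗ[K] MvPolynomial τ K} (hf : koszulD τ K _ p f = 0)
    (hfd : ∀ v, f v ∈ piece J' d)
    {b₀ : (τ → K) [⋀^Fin (p + 2)]→ₗ[K] MvPolynomial τ K} (hb₀ : ∀ v, b₀ v ∈ piece J' (d - 1))
    (hb₀' : koszulD τ K _ (p + 1) b₀ = ((evX y).compAlternatingMap f).compLinearMap (proj y))
    {b₁ : (τ → K) [⋀^Fin (p + 1)]→ₗ[K] MvPolynomial τ K} (hb₁ : ∀ v, b₁ v ∈ piece J' (d - 1))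
    (hb₁' : koszulD τ K _ p b₁ = contraction y f) :
    ∃ b : (τ → K) [⋀^Fin (p + 2)]→ₗ[K] MvPolynomial τ K, (∀ v, b v ∈ piece J' (d - 1)) ∧
      koszulD τ K _ (p + 1) b = f := by
  have hT : ∀ v, (shiftX y).compAlternatingMap f v ∈ piece J' (d - 1) := fun v =>
    shiftX_mem_piece hyJ (hfd v).2
  have hg : ∀ v, (b₁ + ((linX y).compAlternatingMap f).compLinearMap (proj y)) v ∈
      degPiece τ K (d - 1) := fun v =>
    Submodule.add_mem _ (hb₁ v).2 (linX_mem_degPiece y (hfd _).2)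
  have hcyc : koszulD τ K _ p (b₁ + ((linX y).compAlternatingMap f).compLinearMap (proj y)) = 0 := by
    rw [map_add, hb₁', koszulD_linX y hf, add_neg_cancel]
  obtain ⟨b, hb, hb'⟩ := exists_koszulD_eq_mulX (J' := J') hyJ (Or.inl p.succ_ne_zero) hcyc hg
  refine ⟨wedge (form y) ((shiftX y).compAlternatingMap f) + b₀ - wedge (form y) b₁ + b,
    fun v => Submodule.add_mem _ (Submodule.sub_mem _ (Submodule.add_mem _
      (wedge_mem (piece J' (d - 1)) y hT v) (hb₀ v)) (wedge_mem (piece J' (d - 1)) y hb₁ v))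
      (hb v), ?_⟩
  rw [map_add, map_sub, map_add, koszulD_homotopy_succ y f hf, hb', hb₀', koszulD_wedge, hb₁',
    contraction]
  ext v : 1
  simp only [AlternatingMap.add_apply, AlternatingMap.sub_apply,
    LinearMap.compAlternatingMap_apply, LinearMap.mulLeft_apply, mul_add]
  ring

/-- Adjoining one variable to an ideal adds at most the value `1` to the set of all `d` with
`Tor_p(K, J)_{d + p} ≠ 0` for some `p`. -/
lemma IsRetract.hasHomology_or {i : σ → τ} {hi : Function.Injective i} (h : IsRetract hi J J')
    {y : τ} (hy : Set.range i = {y}ᶜ) (hyJ : X y ∈ J') {p : ℕ} {d : ℤ}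
    (hJ : HasHomology J' p d) : d = 1 ∨ ∃ q, HasHomology J q d := by
  by_contra! hcon
  obtain ⟨hd1, hno⟩ := hcon
  obtain ⟨f, hf, hfd, hfb⟩ := hJ
  have hev : ∀ v, ((evX y).compAlternatingMap f).compLinearMap (proj y) v ∈ piece J' d :=
    fun v => evX_mem_piece hyJ (hfd _)
  obtain ⟨b₀, hb₀, hb₀'⟩ := h.exists_koszulD_eq hy (hno p) (evX_comp_proj_mem_koszulCycles y hf)
    hev (evX_comp_proj_idem y f)
  suffices ∃ b : (τ → K) [⋀^Fin (p + 1)]→ₗ[K] MvPolynomial τ K, (∀ v, b v ∈ piece J' (d - 1)) ∧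
      koszulD τ K _ p b = f from this.elim fun b hb => hfb b hb.1 hb.2
  cases p with
  | zero => exact exists_koszulD_eq_zero hyJ hd1 hfd hb₀ hb₀'
  | succ p =>
    have hc : ∀ v, contraction y f v ∈ piece J' d := fun v => evX_mem_piece hyJ (hfd _)
    obtain ⟨b₁, hb₁, hb₁'⟩ := h.exists_koszulD_eq hy (hno p) (contraction_mem_koszulCycles y hf)
      hc (evX_contraction y f)
    exact exists_koszulD_eq_succ hyJ hf hfd hb₀ hb₀' hb₁ hb₁'

end Transport

end Koszul

/-! ### Regularity under the adjunction of variables. -/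

namespace Koszul

variable {σ τ K : Type*} [Fintype σ] [DecidableEq σ] [Fintype τ] [DecidableEq τ] [Field K]

lemma subtype_koszulD (J : Ideal (MvPolynomial τ K)) {p : ℕ} (f : (τ → K) [⋀^Fin (p + 1)]→ₗ[K] J)
    (v : Fin p → τ → K) : (koszulD τ K J p f v : MvPolynomial τ K) =
      koszulD τ K _ p ((J.restrictScalars K).subtype.compAlternatingMap f) v := by
  rw [koszulD_apply, koszulD_apply, ← Submodule.subtype_apply, map_sum]
  rfl

lemma nontrivial_gradedTor_iff_exists {M : Type*} [AddCommGroup M] [Module (MvPolynomial τ K) M]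
    [Module K M] [IsScalarTower K (MvPolynomial τ K) M] (ℳ : ℤ → Submodule K M) (p : ℕ) (j : ℤ) :
    Nontrivial (GradedTor τ ℳ p j) ↔ ∃ f ∈ koszulCycles τ K M p, (∀ v, f v ∈ ℳ (j - p)) ∧
      ∀ g : (τ → K) [⋀^Fin (p + 1)]→ₗ[K] M, (∀ v, g v ∈ ℳ (j - p - 1)) →
        koszulD τ K M p g ≠ f := by
  have hj : j - ((p + 1 : ℕ) : ℤ) = j - p - 1 := by push_cast; ring
  rw [GradedTor, Submodule.Quotient.nontrivial_iff, Ne, Submodule.submoduleOf,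
    Submodule.comap_subtype_eq_top, SetLike.not_le_iff_exists]
  constructor
  · rintro ⟨f, ⟨hf, hfd⟩, hfb⟩
    refine ⟨f, hf, hfd, fun g hg hgf => hfb ⟨g, fun v => ?_, hgf⟩⟩
    rw [hj]
    exact hg v
  · rintro ⟨f, hf, hfd, hfb⟩
    refine ⟨f, ⟨hf, hfd⟩, ?_⟩
    rintro ⟨g, hg, hgf⟩
    refine hfb g (fun v => ?_) hgf
    rw [← hj]
    exact hg v

lemma exists_lift (J : Ideal (MvPolynomial τ K)) {p : ℕ}
    (f : (τ → K) [⋀^Fin p]→ₗ[K] MvPolynomial τ K) (hf : ∀ v, f v ∈ J) :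
    ∃ f' : (τ → K) [⋀^Fin p]→ₗ[K] J, (J.restrictScalars K).subtype.compAlternatingMap f' = f :=
  ⟨f.codRestrict (J.restrictScalars K) hf, rfl⟩

/-- The Koszul complex of `J` is the subcomplex of chains with values in `J` inside that of the
polynomial ring. -/
lemma nontrivial_gradedTor_iff (J : Ideal (MvPolynomial τ K)) (p : ℕ) (j : ℤ) :
    Nontrivial (GradedTor τ J.stdGrading p j) ↔ HasHomology J p (j - p) := by
  have hcyc : ∀ f : (τ → K) [⋀^Fin p]→ₗ[K] J, f ∈ koszulCycles τ K J p ↔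
      (J.restrictScalars K).subtype.compAlternatingMap f ∈ koszulCycles τ K _ p := by
    intro f
    cases p with
    | zero => exact ⟨fun _ => trivial, fun _ => trivial⟩
    | succ p =>
      change koszulD τ K J p f = 0 ↔ koszulD τ K _ p _ = 0
      constructor
      · intro h
        ext v : 1
        rw [← subtype_koszulD, h]
        rfl
      · intro h
        ext v : 2
        rw [subtype_koszulD, h]
        rfl
  rw [nontrivial_gradedTor_iff_exists]
  constructor
  · rintro ⟨f, hf, hfd, hfb⟩
    refine ⟨_, (hcyc f).1 hf, fun v => ⟨(f v).2, hfd v⟩, fun g hg hgf => ?_⟩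
    obtain ⟨g, rfl⟩ := exists_lift J g fun v => (hg v).1
    refine hfb g (fun v => (hg v).2) ?_
    ext v : 2
    rw [subtype_koszulD, hgf]
    rfl
  · rintro ⟨f, hf, hfd, hfb⟩
    obtain ⟨f, rfl⟩ := exists_lift J f fun v => (hfd v).1
    refine ⟨f, (hcyc _).2 hf, fun v => (hfd v).2, fun g hg hgf => ?_⟩
    refine hfb ((J.restrictScalars K).subtype.compAlternatingMap g)
      (fun v => ⟨(g v).2, hg v⟩) ?_
    ext v : 1
    rw [← subtype_koszulD, hgf]
    rfl

lemma reg_eq_sSup (J : Ideal (MvPolynomial τ K)) :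
    J.reg = sSup {d | ∃ p, HasHomology J p d} := by
  unfold Ideal.reg gradedReg
  congr 1
  ext d
  simp only [nontrivial_gradedTor_iff, Set.mem_ofPred_eq]
  constructor
  · rintro ⟨p, j, h, rfl⟩
    exact ⟨p, h⟩
  · rintro ⟨p, h⟩
    exact ⟨p, d + p, by simpa using h, by simp⟩

lemma IsRetract.hasHomology_of_surjective {i : σ → τ} {hi : Function.Injective i}
    {J : Ideal (MvPolynomial σ K)} {J' : Ideal (MvPolynomial τ K)} (h : IsRetract hi J J')
    (hs : Function.Surjective i) {p : ℕ} {d : ℤ} (hJ : HasHomology J' p d) : HasHomology J p d := by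
  let E := Equiv.ofBijective i ⟨hi, hs⟩
  have h1 : ∀ g : MvPolynomial τ K, rename E.symm g = killCompl hi g := fun g => by
    have : g = rename i (rename E.symm g) := by
      rw [rename_rename]
      have : i ∘ E.symm = id := by ext x; exact E.apply_symm_apply x
      rw [this, rename_id_apply]
    conv_rhs => rw [this, killCompl_rename_app]
  have h2 : ∀ g : MvPolynomial σ K, killCompl E.symm.injective g = rename i g := fun g => by
    have : g = rename E.symm (rename i g) := by
      rw [rename_rename]
      have : E.symm ∘ i = id := by ext x; exact E.symm_apply_apply x
      rw [this, rename_id_apply]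
    conv_lhs => rw [this, killCompl_rename_app]
  have : IsRetract E.symm.injective J' J :=
    ⟨fun g hg => by rw [h1]; exact h.killCompl_mem g hg,
      fun g hg => by rw [h2]; exact h.rename_mem g hg⟩
  exact this.hasHomology hJ

lemma IsRetract.hasHomology_or_of_forall_X_mem (n : ℕ) :
    ∀ {τ : Type*} [Fintype τ] [DecidableEq τ] {i : σ → τ} {hi : Function.Injective i}
    {J : Ideal (MvPolynomial σ K)} {J' : Ideal (MvPolynomial τ K)} (_ : IsRetract hi J J')
    (_ : ∀ t, t ∉ Set.range i → X t ∈ J') {p : ℕ} {d : ℤ} (_ : HasHomology J' p d)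
    (_ : Fintype.card τ = n), d = 1 ∨ ∃ q, HasHomology J q d := by
  induction n with
  | zero =>
    intro τ _ _ i hi J J' h hX p d hJ hn
    have := Fintype.card_eq_zero_iff.1 hn
    exact Or.inr ⟨p, h.hasHomology_of_surjective (fun t => isEmptyElim t) hJ⟩
  | succ n ih =>
    intro τ _ _ i hi J J' h hX p d hJ hn
    by_cases hs : Function.Surjective i
    · exact Or.inr ⟨p, h.hasHomology_of_surjective hs hJ⟩
    obtain ⟨y, hy⟩ : ∃ y, y ∉ Set.range i := by simpa [Function.Surjective] using hs
    let i₀ : σ → {t // t ≠ y} := fun s => ⟨i s, fun h => hy ⟨s, h⟩⟩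
    have hi₀ : Function.Injective i₀ := fun a b hab => hi (congrArg Subtype.val hab)
    have hval : Function.Injective (Subtype.val : {t // t ≠ y} → τ) := Subtype.val_injective
    have hr : Set.range (Subtype.val : {t // t ≠ y} → τ) = {y}ᶜ := by ext; simp
    -- The contraction of `J'` to the ring without `y` lies between `J` and `J'`: one variable is
    -- removed from `J'`, and the induction handles the remaining ones.
    let J₀ : Ideal (MvPolynomial {t // t ≠ y} K) := J'.comap (rename Subtype.val)
    have hJ₀ : IsRetract hval J₀ J' := ⟨fun g hg => hg, fun g hg => by
      change rename Subtype.val (killCompl hval g) ∈ J'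
      rw [rename_killCompl hval hr]
      exact J'.sub_mem hg (J'.mul_mem_right _ (hX y hy))⟩
    have hJJ₀ : IsRetract hi₀ J J₀ := by
      refine ⟨fun g hg => ?_, fun g hg => ?_⟩
      · change rename Subtype.val (rename i₀ g) ∈ J'
        rw [rename_rename]
        exact h.rename_mem g hg
      · have : killCompl hi₀ = (killCompl (R := K) hi).comp (rename Subtype.val) := by
          refine MvPolynomial.algHom_ext fun t => ?_
          rw [AlgHom.comp_apply, rename_X]
          by_cases ht : t ∈ Set.range i₀
          · obtain ⟨s, rfl⟩ := ht
            rw [killCompl_X, killCompl_X]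
          · rw [killCompl_X_of_notMem _ ht, killCompl_X_of_notMem]
            exact fun ⟨s, hs⟩ => ht ⟨s, Subtype.ext hs⟩
        rw [this]
        exact h.killCompl_mem _ hg
    rcases hJ₀.hasHomology_or hr (hX y hy) hJ with h1 | ⟨q, hq⟩
    · exact Or.inl h1
    · refine ih hJJ₀ (fun t ht => ?_) hq (by simp [hn])
      change rename Subtype.val (X t) ∈ J'
      rw [rename_X]
      refine hX _ fun ⟨s, hs⟩ => ht ⟨s, Subtype.ext hs⟩

/-- A nonzero element of least degree is a minimal generator: `J` has nothing one degree lower from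
which it could be a boundary. -/
lemma exists_hasHomology_zero {J : Ideal (MvPolynomial τ K)} {n : ℕ} {f : MvPolynomial τ K}
    (hf : f ∈ piece J n) (hf0 : f ≠ 0) :
    ∃ d : ℤ, HasHomology J 0 d ∧ 0 ≤ d ∧ (d = 0 → J = ⊤) := by
  classical
  have hex : ∃ n : ℕ, ∃ f ∈ piece J n, f ≠ 0 := ⟨n, f, hf, hf0⟩
  obtain ⟨g, hg, hg0⟩ := Nat.find_spec hex
  have hmin : ∀ k ∈ piece J ((Nat.find hex : ℤ) - 1), k = 0 := by
    intro k hk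
    by_contra hk0
    obtain ⟨m, hm⟩ := MvPolynomial.ne_zero_iff.1 hk0
    have hmd := hk.2 m hm
    refine Nat.find_min hex (m := m.degree) (by omega) ⟨k, ?_, hk0⟩
    rwa [hmd]
  refine ⟨Nat.find hex, ⟨AlternatingMap.constOfIsEmpty K (τ → K) (Fin 0) g, trivial,
    fun v => hg, fun k hk hkg => hg0 ?_⟩, by positivity, fun h0 => ?_⟩
  · have hk0 : k = 0 := by
      ext v : 1
      exact hmin _ (hk v)
    rw [hk0, map_zero] at hkg
    exact (DFunLike.congr_fun hkg 0).symm
  · obtain ⟨m, hm⟩ := MvPolynomial.ne_zero_iff.1 hg0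
    have hgC : g = C (coeff 0 g) := by
      ext m'
      rw [coeff_C]
      split_ifs with h
      · rw [h]
      · by_contra hm'
        have := hg.2 m' hm'
        rw [h0, Nat.cast_eq_zero, Finsupp.degree_eq_zero_iff] at this
        exact h this.symm
    have hc : coeff 0 g ≠ 0 := fun h => hg0 (by rw [hgC, h, C_0])
    refine Ideal.eq_top_of_isUnit_mem _ hg.1 ?_
    rw [hgC]
    exact (isUnit_iff_ne_zero.2 hc).map C

/-- In the unbounded case both suprema take the same default value, so finiteness of the regularity
need not be known. -/
lemma Int.sSup_eq_of_cofinal {S S' : Set ℤ} (hne : S.Nonempty) (h : S ⊆ S')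
    (h' : ∀ x ∈ S', ∃ y ∈ S, x ≤ y) : sSup S = sSup S' := by
  by_cases hb : BddAbove S'
  · refine le_antisymm (csSup_le_csSup hb hne h) (csSup_le (hne.mono h) fun x hx => ?_)
    obtain ⟨y, hy, hxy⟩ := h' x hx
    exact hxy.trans (le_csSup (hb.mono h) hy)
  · have hnb : ¬ BddAbove S := fun ⟨b, hb''⟩ => hb ⟨b, fun x hx => by
      obtain ⟨y, hy, hxy⟩ := h' x hx
      exact hxy.trans (hb'' hy)⟩
    rw [Int.csSup_of_not_bddAbove hb, Int.csSup_of_not_bddAbove hnb]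

/-- Adjoining variables to a nonzero homogeneous ideal does not change its regularity. -/
theorem IsRetract.reg_eq {i : σ → τ} {hi : Function.Injective i}
    {J : Ideal (MvPolynomial σ K)} {J' : Ideal (MvPolynomial τ K)} (h : IsRetract hi J J')
    (hX : ∀ t, t ∉ Set.range i → X t ∈ J') {n : ℕ} {f : MvPolynomial σ K}
    (hf : f ∈ piece J n) (hf0 : f ≠ 0) : J'.reg = J.reg := by
  obtain ⟨d, hd, hd0, hdtop⟩ := exists_hasHomology_zero hf hf0
  rw [reg_eq_sSup, reg_eq_sSup]
  symm
  refine Int.sSup_eq_of_cofinal ⟨d, 0, hd⟩ (fun x ⟨p, hx⟩ => ⟨p, h.hasHomology hx⟩) ?_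
  rintro x ⟨p, hx⟩
  -- If `d = 0`, both ideals are the whole ring and exactness excludes positive values. Otherwise `d
  -- ≥ 1` dominates the extra value `1`.
  by_cases hz : d = 0
  · refine ⟨d, ⟨0, hd⟩, ?_⟩
    have hJ' : J' = ⊤ := by
      rw [Ideal.eq_top_iff_one, ← map_one (rename i)]
      exact h.rename_mem 1 (by rw [hdtop hz]; trivial)
    by_contra hlt
    obtain ⟨f, hf, hfd, hfb⟩ := hx
    obtain ⟨k, hk, hkf⟩ := koszul_exact (Or.inr (by omega)) hf fun v => (hfd v).2
    exact hfb k (fun v => ⟨by rw [hJ']; trivial, hk v⟩) hkf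
  · rcases h.hasHomology_or_of_forall_X_mem _ hX hx rfl with rfl | hq
    · exact ⟨d, ⟨0, hd⟩, by omega⟩
    · exact ⟨x, hq, le_rfl⟩

end Koszul

/-! ### Eventually linear functions and max-plus recursions. -/

section EventuallyLinear

open Filter

/-- The function agrees with an affine function for all large arguments. -/
def EventuallyLinear (f : ℕ+ → ℤ) : Prop :=
  ∃ C D : ℤ, ∀ᶠ n : ℕ+ in atTop, f n = C * (n : ℤ) + D

lemma EventuallyLinear.congr {f g : ℕ+ → ℤ} (hf : EventuallyLinear f)
    (h : ∀ᶠ n in atTop, g n = f n) : EventuallyLinear g := by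
  obtain ⟨C, D, hC⟩ := hf
  exact ⟨C, D, by filter_upwards [hC, h] with n h1 h2 using h2.trans h1⟩

lemma EventuallyLinear.add_const {f : ℕ+ → ℤ} (hf : EventuallyLinear f) (a : ℤ) :
    EventuallyLinear fun n => f n + a := by
  obtain ⟨C, D, hC⟩ := hf
  exact ⟨C, D + a, by filter_upwards [hC] with n h1; rw [h1]; ring⟩

lemma eventually_le_pnat (a : ℤ) : ∀ᶠ n : ℕ+ in atTop, a ≤ (n : ℤ) := by
  filter_upwards [eventually_ge_atTop (Nat.succPNat a.toNat)] with n hn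
  have h : (Nat.succPNat a.toNat : ℕ) ≤ n := hn
  rw [Nat.succPNat_coe] at h
  omega

lemma eventually_linear_le {C₁ D₁ C₂ D₂ : ℤ} (h : C₁ < C₂) :
    ∀ᶠ n : ℕ+ in atTop, C₁ * (n : ℤ) + D₁ ≤ C₂ * (n : ℤ) + D₂ := by
  filter_upwards [eventually_le_pnat (D₁ - D₂)] with n hn
  have hn0 : (0 : ℤ) ≤ n := by positivity
  nlinarith

lemma EventuallyLinear.max {f g : ℕ+ → ℤ} (hf : EventuallyLinear f) (hg : EventuallyLinear g) :
    EventuallyLinear fun n => max (f n) (g n) := by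
  obtain ⟨C₁, D₁, h₁⟩ := hf
  obtain ⟨C₂, D₂, h₂⟩ := hg
  rcases lt_trichotomy C₁ C₂ with h | rfl | h
  · refine ⟨C₂, D₂, ?_⟩
    filter_upwards [h₁, h₂, eventually_linear_le h] with n e₁ e₂ hle
    rw [e₁, e₂, max_eq_right hle]
  · refine ⟨C₁, Max.max D₁ D₂, ?_⟩
    filter_upwards [h₁, h₂] with n e₁ e₂
    rw [e₁, e₂, max_add_add_left]
  · refine ⟨C₁, D₁, ?_⟩
    filter_upwards [h₁, h₂, eventually_linear_le h] with n e₁ e₂ hle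
    rw [e₁, e₂, max_eq_left hle]

lemma EventuallyLinear.sup' {ι : Type*} {s : Finset ι} (hs : s.Nonempty) {g : ι → ℕ+ → ℤ}
    (h : ∀ i ∈ s, EventuallyLinear (g i)) :
    EventuallyLinear fun n => s.sup' hs fun i => g i n := by
  induction hs using Finset.Nonempty.cons_induction with
  | singleton a => simpa using h
  | cons a s ha hs ih =>
    simp only [Finset.sup'_cons hs]
    exact (h a (by simp)).max (ih fun i hi => h i (by simp [hi]))

lemma PNat.le_induction_on {N : ℕ+} {P : ℕ+ → Prop} (h0 : P N)
    (hs : ∀ n, N ≤ n → P n → P (n + 1)) : ∀ n, N ≤ n → P n := by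
  intro n
  induction n using PNat.recOn with
  | one => intro h; rwa [← le_antisymm h one_le]
  | succ n ih =>
    intro h
    rcases h.lt_or_eq with h | h
    · exact hs n (PNat.lt_add_one_iff.1 h) (ih (PNat.lt_add_one_iff.1 h))
    · rwa [← h]

lemma eventuallyLinear_of_succ {f : ℕ+ → ℤ} {a : ℤ} {N : ℕ+}
    (h : ∀ n, N ≤ n → f (n + 1) = f n + a) : EventuallyLinear f := by
  refine ⟨a, f N - a * N, eventually_atTop.2 ⟨N, ?_⟩⟩
  refine PNat.le_induction_on (by ring) fun n hn ih => ?_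
  rw [h n hn, ih]
  push_cast
  ring

/-- If `f n + a` always attains the maximum, `f` has slope `a`. Otherwise `f` meets the line `L` at
some point, and from there the larger of the slopes `C` and `a` wins for good. -/
lemma eventuallyLinear_of_succ_eq_max {f L : ℕ+ → ℤ} {a : ℤ} (hL : EventuallyLinear L)
    (h : ∀ᶠ n in atTop, f (n + 1) = max (L (n + 1)) (f n + a)) : EventuallyLinear f := by
  obtain ⟨C, D, hC⟩ := hL
  obtain ⟨N, hN⟩ := eventually_atTop.1 (h.and hC)
  have hrec : ∀ n, N ≤ n → f (n + 1) = max (C * ((n : ℤ) + 1) + D) (f n + a) := fun n hn => by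
    rw [(hN n hn).1, (hN (n + 1) (hn.trans (PNat.lt_add_right n 1).le)).2]
    push_cast
    rfl
  by_cases hall : ∀ n, N ≤ n → C * ((n : ℤ) + 1) + D ≤ f n + a
  · exact eventuallyLinear_of_succ fun n hn => by rw [hrec n hn, max_eq_right (hall n hn)]
  push Not at hall
  obtain ⟨n₀, hn₀, hlt⟩ := hall
  have hle : ∀ n, n₀ + 1 ≤ n → N ≤ n := fun n hn =>
    hn₀.trans ((PNat.lt_add_right n₀ 1).le.trans hn)
  have hbase : f (n₀ + 1) = C * (((n₀ + 1 : ℕ+) : ℤ)) + D := by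
    rw [hrec n₀ hn₀, max_eq_left hlt.le]
    push_cast
    rfl
  rcases le_or_gt C a with hCa | hCa
  · have hge : ∀ n, n₀ + 1 ≤ n → C * (n : ℤ) + D ≤ f n := by
      refine PNat.le_induction_on hbase.ge fun n hn _ => ?_
      rw [hrec n (hle n hn)]
      push_cast
      exact le_max_left _ _
    refine eventuallyLinear_of_succ (a := a) (N := n₀ + 1) fun n hn => ?_
    rw [hrec n (hle n hn), max_eq_right]
    linarith [hge n hn]
  · refine ⟨C, D, eventually_atTop.2 ⟨n₀ + 1, ?_⟩⟩
    refine PNat.le_induction_on hbase fun n hn ih => ?_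
    rw [hrec n (hle n hn), max_eq_left]
    · push_cast
      rfl
    · rw [ih]; linarith

lemma eventually_pnat_succ {P : ℕ+ → Prop} (h : ∀ᶠ n in atTop, P n) :
    ∀ᶠ n in atTop, P (n + 1) := by
  obtain ⟨N, hN⟩ := eventually_atTop.1 h
  exact eventually_atTop.2 ⟨N, fun n hn => hN _ (hn.trans (PNat.lt_add_right n 1).le)⟩

/-- A maximum of finitely many functions, each of which is eventually linear or a translate of
the maximum itself, is eventually linear. -/
theorem eventuallyLinear_of_isGreatest {ι : Type*} {E : Set ι} (hE : E.Finite) {f : ℕ+ → ℤ}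
    {g : ι → ℕ+ → ℤ} (hf : ∀ᶠ n in atTop, IsGreatest ((fun i => g i n) '' E) (f n))
    (hg : ∀ i ∈ E, EventuallyLinear (g i) ∨ ∃ a : ℤ, ∀ᶠ n in atTop, g i (n + 1) = f n + a) :
    EventuallyLinear f := by
  classical
  -- The terms in `B` are translates of `f`; together they contribute `f n + max a` at `n + 1`. The
  -- terms in `A` have an eventually linear maximum.
  set A : Finset ι := hE.toFinset.filter fun i => EventuallyLinear (g i) with hA
  set B : Finset ι := hE.toFinset.filter fun i => ¬ EventuallyLinear (g i) with hB
  have hmemA : ∀ i, i ∈ A ↔ i ∈ E ∧ EventuallyLinear (g i) := by simp [hA]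
  have hmemB : ∀ i, i ∈ B ↔ i ∈ E ∧ ¬ EventuallyLinear (g i) := by simp [hB]
  have hB' : ∀ i ∈ B, ∃ a : ℤ, ∀ᶠ n in atTop, g i (n + 1) = f n + a := fun i hi =>
    (hg i ((hmemB i).1 hi).1).resolve_left ((hmemB i).1 hi).2
  choose! a ha using hB'
  have haB : ∀ᶠ n in atTop, ∀ i ∈ B, g i (n + 1) = f n + a i :=
    (Filter.eventually_all_finset B).2 ha
  have hf' := eventually_pnat_succ hf
  have hcases : ∀ i ∈ E, i ∈ A ∨ i ∈ B := fun i hi => by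
    by_cases h : EventuallyLinear (g i)
    · exact Or.inl ((hmemA i).2 ⟨hi, h⟩)
    · exact Or.inr ((hmemB i).2 ⟨hi, h⟩)
  rcases A.eq_empty_or_nonempty with hA0 | hA0
  · have hB0 : B.Nonempty := by
      obtain ⟨n, hn⟩ := hf.exists
      obtain ⟨i, hi, -⟩ := hn.1
      exact ⟨i, (hcases i hi).resolve_left (by simp [hA0])⟩
    obtain ⟨N, hN⟩ := eventually_atTop.1 (haB.and hf')
    refine eventuallyLinear_of_succ (a := B.sup' hB0 a) (N := N) fun n hn => ?_
    obtain ⟨h1, h2⟩ := hN n hn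
    refine h2.unique ⟨?_, ?_⟩
    · obtain ⟨i, hi, hia⟩ := B.exists_mem_eq_sup' hB0 a
      exact ⟨i, ((hmemB i).1 hi).1, by simp only; rw [h1 i hi, hia]⟩
    · rintro _ ⟨i, hi, rfl⟩
      have hi' := (hcases i hi).resolve_left (by simp [hA0])
      simp only
      rw [h1 i hi']
      linarith [B.le_sup' a hi']
  have hLA := EventuallyLinear.sup' hA0 fun i hi => ((hmemA i).1 hi).2
  rcases B.eq_empty_or_nonempty with hB0 | hB0
  · refine hLA.congr ?_
    filter_upwards [hf] with n hn
    refine hn.unique ⟨?_, ?_⟩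
    · obtain ⟨i, hi, hia⟩ := A.exists_mem_eq_sup' hA0 fun i => g i n
      exact ⟨i, ((hmemA i).1 hi).1, hia.symm⟩
    · rintro _ ⟨i, hi, rfl⟩
      exact A.le_sup' (fun i => g i n) ((hcases i hi).resolve_right (by simp [hB0]))
  · refine eventuallyLinear_of_succ_eq_max (a := B.sup' hB0 a) hLA ?_
    filter_upwards [haB, hf'] with n h1 h2
    refine h2.unique ⟨?_, ?_⟩
    · rcases max_choice (A.sup' hA0 fun i => g i (n + 1)) (f n + B.sup' hB0 a) with h | h
      · obtain ⟨i, hi, hia⟩ := A.exists_mem_eq_sup' hA0 fun i => g i (n + 1)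
        exact ⟨i, ((hmemA i).1 hi).1, by rw [h, hia]⟩
      · obtain ⟨i, hi, hia⟩ := B.exists_mem_eq_sup' hB0 a
        exact ⟨i, ((hmemB i).1 hi).1, by simp only; rw [h, h1 i hi, hia]⟩
    · rintro _ ⟨i, hi, rfl⟩
      rcases hcases i hi with hi' | hi'
      · exact (A.le_sup' (fun i => g i (n + 1)) hi').trans (le_max_left _ _)
      · refine le_trans ?_ (le_max_right _ _)
        simp only
        rw [h1 i hi']
        linarith [B.le_sup' a hi']

end EventuallyLinear

namespace IncChain

open Filter

/-! ### Words of columns and their well-quasi-order. -/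

section Words

variable {c : ℕ}

/-- A monomial whose first `i` columns are fixed by `Inc(ℕ)^i`, as the tuple of its first `i`
columns followed by the list of the others. -/
abbrev Word (c i : ℕ) : Type := (Fin i → Fin c → ℕ) × List (Fin c → ℕ)

/-- The quasi-order on words induced by divisibility up to the action of `Inc(ℕ)^i`. -/
def Word.le {i : ℕ} (w w' : Word c i) : Prop :=
  w.1 ≤ w'.1 ∧ List.SublistForall₂ (· ≤ ·) w.2 w'.2

/-- Dickson's lemma for the fixed columns and Higman's lemma for the list of the others. -/
lemma wellQuasiOrdered_le (i : ℕ) : WellQuasiOrdered (Word.le : Word c i → Word c i → Prop) := by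
  refine WellQuasiOrdered.prod (_root_.wellQuasiOrdered_le (α := Fin i → Fin c → ℕ)) ?_
  have h := Set.PartiallyWellOrderedOn.partiallyWellOrderedOn_sublistForall₂
    (α := Fin c → ℕ) (· ≤ ·) (Set.isPWO_of_wellQuasiOrderedLE Set.univ)
  rw [← Set.partiallyWellOrderedOn_univ_iff]
  refine h.mono fun l _ => ?_
  simp

/-- Inclusion of the words of large length. -/
def EventuallySubset {i : ℕ} (A B : Set (Word c i)) : Prop :=
  ∃ N, ∀ w ∈ A, N ≤ w.2.length → w ∈ B

/-- The sets of words closed upwards. -/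
abbrev UpperSets (c i : ℕ) : Type :=
  {A : Set (Word c i) // ∀ w ∈ A, ∀ w', Word.le w w' → w' ∈ A}

/-- The larger set is the smaller one in this relation, so this is an ascending chain condition. In
a strictly growing sequence, pick `w n` new in `A (n + 1)`. Some earlier `w a` lies below `w b`,
which puts `w b` into `A (a + 1)`, and its length carries it on to `A b`, a contradiction. -/
lemma wellFounded_eventuallySubset (i : ℕ) : WellFounded fun B A : UpperSets c i =>
    EventuallySubset A.1 B.1 ∧ ¬ EventuallySubset B.1 A.1 := by
  rw [wellFounded_iff_isEmpty_descending_chain]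
  refine ⟨fun ⟨A, hA⟩ => ?_⟩
  -- Each inclusion holds only beyond a length `N j`. Taking `w n` longer than the sum of these
  -- bounds puts it beyond all of them for `j ≤ n`.
  choose N hN using fun n => (hA n).1
  have hw : ∀ n, ∃ w ∈ (A (n + 1)).1, ∑ j ∈ Finset.range (n + 1), N j ≤ w.2.length ∧
      w ∉ (A n).1 := fun n => by
    have := (hA n).2
    simp only [EventuallySubset, not_exists] at this
    specialize this (∑ j ∈ Finset.range (n + 1), N j)
    push Not at this
    exact this
  choose w hw1 hw2 hw3 using hw
  obtain ⟨a, b, hab, hle⟩ := wellQuasiOrdered_le i w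
  have key : ∀ j, a + 1 ≤ j → j ≤ b → w b ∈ (A j).1 := by
    intro j hj
    induction j, hj using Nat.le_induction with
    | base => exact fun _ => (A (a + 1)).2 _ (hw1 a) _ hle
    | succ j hj ih =>
      intro hjb
      refine hN j _ (ih (by omega)) (le_trans ?_ (hw2 b))
      exact Finset.single_le_sum (f := N) (fun _ _ => Nat.zero_le _)
        (Finset.mem_range.2 (by omega))
  exact hw3 b (key b hab le_rfl)

/-- The columns of the monomial `(a, 0^k, l)`, for a word `(a, l)`. -/
def Word.col {i : ℕ} (k : ℕ) (w : Word c i) (j : ℕ) : Fin c → ℕ :=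
  if h : j < i then w.1 ⟨j, h⟩ else if j < i + k then 0 else w.2.getD (j - (i + k)) 0

/-- The exponent vector with given columns. -/
noncomputable def expo (n : ℕ) (u : ℕ → Fin c → ℕ) : Fin c × Fin n →₀ ℕ :=
  Finsupp.equivFunOnFinite.symm fun x => u x.2 x.1

lemma expo_apply (n : ℕ) (u : ℕ → Fin c → ℕ) (x : Fin c × Fin n) : expo n u x = u x.2 x.1 := rfl

/-- The map is needed on all of `ℕ`, because elements of `Inc` are. Positions beyond `l` go to
positions beyond `l'`, where both entries default to `0`. -/
lemma exists_strictMono_of_sublistForall₂ {l l' : List (Fin c → ℕ)}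
    (h : List.SublistForall₂ (· ≤ ·) l l') :
    ∃ f : ℕ → ℕ, StrictMono f ∧ (∀ j, j < l.length → f j < l'.length) ∧
      ∀ j, l.getD j 0 ≤ l'.getD (f j) 0 := by
  obtain ⟨m, hm, hml⟩ := List.sublistForall₂_iff.1 h
  obtain ⟨f, hf⟩ := List.sublist_iff_exists_orderEmbedding_getElem?_eq.1 hml
  obtain ⟨hlen, hget⟩ := List.forall₂_iff_get.1 hm
  refine ⟨f, f.strictMono, fun j hj => ?_, fun j => ?_⟩
  · have h1 := hf j
    rw [List.getElem?_eq_getElem (hlen ▸ hj)] at h1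
    exact (List.getElem?_eq_some_iff.1 h1.symm).1
  · rw [List.getD_eq_getElem?_getD, List.getD_eq_getElem?_getD, ← hf j]
    by_cases hj : j < l.length
    · rw [List.getElem?_eq_getElem hj, List.getElem?_eq_getElem (hlen ▸ hj)]
      exact hget j hj (hlen ▸ hj)
    · rw [List.getElem?_eq_none (by omega), List.getElem?_eq_none (by omega)]

end Words

/-! ### Chains, their words, and the induction. -/

variable {K : Type*} [Field K] {c : ℕ}

lemma colIncl_injective {m n : ℕ} {π : ℕ → ℕ} (hπ : StrictMono π) (h : ∀ j : Fin m, π j < n) :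
    Function.Injective fun x : Fin c × Fin m => ((x.1, ⟨π x.2, h x.2⟩) : Fin c × Fin n) := by
  rintro ⟨a, j⟩ ⟨b, j'⟩ hab
  simp only [Prod.mk.injEq, Fin.mk.injEq] at hab
  exact Prod.ext hab.1 (Fin.ext (hπ.injective hab.2))

lemma monomial_mem_of_le {σ : Type*} {J : Ideal (MvPolynomial σ K)} {a b : σ →₀ ℕ} (h : a ≤ b)
    (ha : monomial a (1 : K) ∈ J) : monomial b (1 : K) ∈ J := by
  have : monomial b (1 : K) = monomial (b - a) 1 * monomial a 1 := by
    rw [monomial_mul, tsub_add_cancel_of_le h, one_mul]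
  rw [this]
  exact J.mul_mem_left _ ha

lemma IsInvariant.monomial_mem {i : ℕ} {I : Chain K c} (hI : IsInvariant i I) {m n : ℕ+}
    (hmn : m ≤ n) {π : ℕ → ℕ} (hπ : π ∈ Inc i) (h : ∀ j : Fin m, π j < n)
    {a : Fin c × Fin m →₀ ℕ} {b : Fin c × Fin n →₀ ℕ} (ha : monomial a (1 : K) ∈ I m)
    (hab : ∀ x : Fin c × Fin m, a x ≤ b (x.1, ⟨π x.2, h x.2⟩)) : monomial b (1 : K) ∈ I n := by
  have h1 : act π h (monomial a (1 : K)) ∈ I n := hI m n hmn ⟨π, hπ, h, _, ha, rfl⟩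
  rw [act, rename_monomial] at h1
  refine monomial_mem_of_le (fun y => ?_) h1
  by_cases hy : y ∈ Set.range fun x : Fin c × Fin m => ((x.1, ⟨π x.2, h x.2⟩) : Fin c × Fin n)
  · obtain ⟨x, rfl⟩ := hy
    rw [Finsupp.mapDomain_apply (colIncl_injective hπ.1 h)]
    exact hab x
  · rw [Finsupp.mapDomain_of_notMem_range _ _ hy]
    exact Nat.zero_le _

/-- The words `(a, l)` such that the monomial `(a, 0^k, l)` belongs to the chain. -/
def words (i k : ℕ) (I : Chain K c) : Set (Word c i) :=
  {w | ∃ n : ℕ+, (n : ℕ) = i + k + w.2.length ∧ monomial (expo n (w.col k)) (1 : K) ∈ I n}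

lemma IsInvariant.mem_words_of_le {i k : ℕ} {I : Chain K c} (hI : IsInvariant (i + k) I)
    (w : Word c i) (hw : w ∈ words i k I) (w' : Word c i) (h : Word.le w w') :
    w' ∈ words i k I := by
  obtain ⟨n, hn, hwn⟩ := hw
  obtain ⟨f, hf, hfl, hfle⟩ := exists_strictMono_of_sublistForall₂ h.2
  have hlen : w.2.length ≤ w'.2.length := by
    obtain ⟨m, hm, hml⟩ := List.sublistForall₂_iff.1 h.2
    rw [hm.length_eq]
    exact hml.length_le
  have hpos := n.pos
  let n' : ℕ+ := ⟨i + k + w'.2.length, by omega⟩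
  have hn' : (n' : ℕ) = i + k + w'.2.length := rfl
  -- The embedding of lists acts on the columns after the first `i + k`, which stay fixed, so the
  -- block of zero columns is preserved.
  let π : ℕ → ℕ := fun j => if j < i + k then j else i + k + f (j - (i + k))
  have hπ : π ∈ Inc (i + k) := by
    refine ⟨fun a b hab => ?_, fun j hj => if_pos hj⟩
    simp only [π]
    split_ifs with h1 h2 h2
    · exact hab
    · omega
    · omega
    · have := hf (show a - (i + k) < b - (i + k) by omega)
      omega
  have hπn : ∀ j : Fin n, π j < n' := fun j => by
    have hj := j.2
    simp only [π]
    rw [hn']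
    split_ifs with h1
    · omega
    · have := hfl (j - (i + k)) (by omega)
      omega
  refine ⟨n', hn', hI.monomial_mem (show (n : ℕ) ≤ n' by omega) hπ hπn hwn fun x => ?_⟩
  rw [expo_apply, expo_apply]
  simp only [Word.col, π]
  by_cases h1 : (x.2 : ℕ) < i
  · have h2 : (x.2 : ℕ) < i + k := by omega
    rw [dif_pos h1]
    simp only [h2, if_true]
    rw [dif_pos h1]
    exact h.1 _ _
  · by_cases h2 : (x.2 : ℕ) < i + k
    · rw [dif_neg h1, if_pos h2]
      exact Nat.zero_le _
    · rw [dif_neg h1, if_neg h2]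
      simp only [h2, if_false]
      rw [dif_neg (by omega), if_neg (by omega), Nat.add_sub_cancel_left]
      exact hfle _ _

/-- The map skipping the column `i`. -/
def skip (i : ℕ) (j : ℕ) : ℕ := if j < i then j else j + 1

lemma skip_mem_Inc (i : ℕ) : skip i ∈ Inc i := by
  refine ⟨fun a b hab => ?_, fun j hj => if_pos hj⟩
  simp only [skip]
  split_ifs <;> omega

lemma skip_lt (i : ℕ) (n : ℕ+) (j : Fin n) : skip i j < (n + 1 : ℕ+) := by
  have := j.2
  simp only [skip, PNat.add_coe, PNat.val_ofNat]
  split_ifs <;> omega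

lemma col_skip {i k : ℕ} (w : Word c i) (j : ℕ) : w.col (k + 1) (skip (i + k) j) = w.col k j := by
  simp only [Word.col, skip]
  by_cases h1 : j < i
  · have h2 : j < i + k := by omega
    simp only [h2, if_true, h1, dif_pos]
  · by_cases h2 : j < i + k
    · simp only [h2, if_true, h1, dif_neg, not_false_iff]
      rw [if_pos (by omega)]
    · simp only [h2, if_false, h1]
      rw [dif_neg (by omega), dif_neg (by simp), if_neg (by omega)]
      congr 1
      omega

/-- The embedding of variables skipping the column `i`. -/
abbrev skipVar (c i : ℕ) (n : ℕ+) (x : Fin c × Fin n) : Fin c × Fin (n + 1 : ℕ+) :=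
  (x.1, ⟨skip i x.2, skip_lt i n x.2⟩)

lemma skipVar_injective (c i : ℕ) (n : ℕ+) : Function.Injective (skipVar c i n) :=
  colIncl_injective (skip_mem_Inc i).1 (skip_lt i n)

lemma eq_of_notMem_range_skipVar {i : ℕ} {n : ℕ+} (hi : i ≤ n) {t : Fin c × Fin (n + 1 : ℕ+)}
    (ht : t ∉ Set.range (skipVar c i n)) : (t.2 : ℕ) = i := by
  by_contra hne
  have h2 : (t.2 : ℕ) < n + 1 := t.2.2
  refine ht ⟨(t.1, ⟨if (t.2 : ℕ) < i then t.2 else t.2 - 1, by split_ifs <;> omega⟩),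
    Prod.ext rfl (Fin.ext ?_)⟩
  simp only [skip]
  split_ifs <;> omega

lemma mapDomain_skipVar_expo {i k : ℕ} {n : ℕ+} (hn : i + k ≤ n) (w : Word c i) :
    (expo n (w.col k)).mapDomain (skipVar c (i + k) n) =
      expo (n + 1 : ℕ+) (w.col (k + 1)) := by
  ext x
  by_cases hx : x ∈ Set.range (skipVar c (i + k) n)
  · obtain ⟨x, rfl⟩ := hx
    rw [Finsupp.mapDomain_apply (skipVar_injective c (i + k) n), expo_apply, expo_apply]
    simp only
    rw [col_skip]
  · rw [Finsupp.mapDomain_of_notMem_range _ _ hx, expo_apply,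
      eq_of_notMem_range_skipVar hn hx, Word.col, dif_neg (by omega), if_pos (by omega)]
    rfl

lemma colonChain_eq {i : ℕ} {I : Chain K c} {n : ℕ+} (h : ind i I < n ∧ i < n) (e : Fin c → ℕ) :
    colonChain i I e n = (I n).colon {∏ k : Fin c, X (k, ⟨i, h.2⟩) ^ e k} ⊔
      Ideal.span (Set.range fun k : Fin c => X (k, ⟨i, h.2⟩)) := dif_pos h

lemma le_colonChain {i : ℕ} {I : Chain K c} {n : ℕ+} (h : ind i I < n ∧ i < n) (e : Fin c → ℕ) :
    I n ≤ colonChain i I e n := by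
  rw [colonChain_eq h]
  refine le_trans (fun f hf => ?_) le_sup_left
  rw [Submodule.mem_colon_singleton]
  exact (I n).mul_mem_right _ hf

lemma X_mem_colonChain {i : ℕ} {I : Chain K c} {n : ℕ+} (h : ind i I < n ∧ i < n)
    (e : Fin c → ℕ) (t : Fin c) : X (t, ⟨i, h.2⟩) ∈ colonChain i I e n := by
  rw [colonChain_eq h]
  exact Ideal.mem_sup_right (Ideal.subset_span ⟨t, rfl⟩)

lemma colonChain_mono {i : ℕ} {I : Chain K c} {n : ℕ+} {e e' : Fin c → ℕ} (h : e ≤ e') :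
    colonChain i I e n ≤ colonChain i I e' n := by
  by_cases hn : ind i I < n ∧ i < n
  · rw [colonChain_eq hn, colonChain_eq hn]
    refine sup_le_sup_right (fun f hf => ?_) _
    rw [Submodule.mem_colon_singleton, smul_eq_mul] at hf ⊢
    have : ∏ k : Fin c, (X (k, ⟨i, hn.2⟩) : PolyRing K c n) ^ e' k =
        (∏ k : Fin c, X (k, ⟨i, hn.2⟩) ^ e k) * ∏ k : Fin c, X (k, ⟨i, hn.2⟩) ^ (e' k - e k) := by
      rw [← Finset.prod_mul_distrib]
      refine Finset.prod_congr rfl fun k _ => ?_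
      rw [← pow_add, Nat.add_sub_cancel' (h k)]
    rw [this, ← mul_assoc]
    exact (I n).mul_mem_right _ hf
  · rw [colonChain, dif_neg hn]
    exact bot_le

/-- An infinite `E` contains, by Dickson's lemma, a strictly increasing sequence of exponents. The
ideals `I_{e,n}` increase along it and stabilise by noetherianity, so their regularity is eventually
constant while `|e|` is unbounded. This contradicts the existence of a maximum. -/
lemma finite_of_isGreatest {i : ℕ} {I : Chain K c} {n : ℕ+} {E : Set (Fin c → ℕ)} {b : ℤ}
    (h : IsGreatest ((fun e => (colonChain i I e n).reg + ∑ k, (e k : ℤ)) '' E) b) :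
    E.Finite := by
  by_contra hE
  have hE : E.Infinite := hE
  let u : ℕ → Fin c → ℕ := fun m => hE.natEmbedding _ m
  have huE : ∀ m, u m ∈ E := fun m => (hE.natEmbedding _ m).2
  have hu : Function.Injective u := Subtype.val_injective.comp (hE.natEmbedding _).injective
  obtain ⟨g, hg⟩ := (_root_.wellQuasiOrdered_le (α := Fin c → ℕ)).exists_monotone_subseq u
  have hlt : StrictMono fun m => ∑ k, u (g m) k := by
    refine strictMono_nat_of_lt_succ fun m => ?_
    have hle := hg m (m + 1) (Nat.le_succ m)
    have hne : u (g m) ≠ u (g (m + 1)) := fun h =>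
      absurd (g.injective (hu h)) (Nat.succ_ne_self m).symm
    obtain ⟨k, hk⟩ := Function.ne_iff.1 hne
    exact Finset.sum_lt_sum (fun k _ => hle k) ⟨k, Finset.mem_univ _, (hle k).lt_of_ne hk⟩
  let F : ℕ →o Ideal (PolyRing K c n) :=
    ⟨fun m => colonChain i I (u (g m)) n, fun a b hab => colonChain_mono (hg a b hab)⟩
  obtain ⟨M, hM⟩ := monotone_stabilizes_iff_noetherian.2
    (inferInstance : IsNoetherianRing (PolyRing K c n)) F
  have hbound : ∀ m, M ≤ m → ((∑ k, u (g m) k : ℕ) : ℤ) ≤ b - (F M).reg := fun m hm => by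
    have := h.2 ⟨u (g m), huE _, rfl⟩
    simp only at this
    rw [hM m hm]
    push_cast
    exact le_sub_iff_add_le'.2 this
  have h1 := hbound (M + (b - (F M).reg).toNat + 1) (by omega)
  have h2 := hlt.id_le (M + (b - (F M).reg).toNat + 1)
  simp only [id] at h2
  have h3 := Int.self_le_toNat (b - (F M).reg)
  omega

lemma eventually_lt_pnat (N : ℕ) : ∀ᶠ n : ℕ+ in atTop, N < (n : ℕ) := by
  filter_upwards [eventually_ge_atTop (Nat.succPNat N)] with n hn
  exact hn

lemma eventually_ne_bot {i : ℕ} {I : Chain K c} (h : (i, I) ∈ family K c) :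
    ∀ᶠ n : ℕ+ in atTop, ∃ a, monomial a (1 : K) ∈ I n := by
  obtain ⟨⟨m, hm⟩, hmon, hinv⟩ := h
  obtain ⟨A, hA⟩ := hmon m
  have hne : A.Nonempty := by
    by_contra h0
    rw [Set.not_nonempty_iff_eq_empty] at h0
    apply hm
    rw [hA, h0]
    simp
  obtain ⟨a, ha⟩ := hne
  filter_upwards [eventually_ge_atTop m] with n hn
  have hmn : (m : ℕ) ≤ n := hn
  have hid : ∀ j : Fin m, id (j : ℕ) < (n : ℕ) := fun j => j.2.trans_le hmn
  have := hinv m n hn ⟨id, ⟨strictMono_id, fun _ _ => rfl⟩, hid, monomial a 1,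
    by rw [hA]; exact Ideal.subset_span ⟨a, ha, rfl⟩, rfl⟩
  rw [act, rename_monomial] at this
  exact ⟨_, this⟩

/-- Columns `i, …, i + k - 1` of variables eventually belong to the ideals of the chain. -/
def ContainsColumns (i k : ℕ) (I : Chain K c) : Prop :=
  ∀ᶠ n : ℕ+ in atTop, ∀ x : Fin c × Fin n, i ≤ x.2 → (x.2 : ℕ) < i + k → X x ∈ I n

lemma ContainsColumns.colonChain {i k : ℕ} {I : Chain K c} (h : ContainsColumns i k I)
    (e : Fin c → ℕ) : ContainsColumns i (k + 1) (colonChain (i + k) I e) := by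
  filter_upwards [h, eventually_lt_pnat (ind (i + k) I), eventually_lt_pnat (i + k)]
    with n hn h1 h2 x hx hxk
  by_cases hk : (x.2 : ℕ) < i + k
  · exact le_colonChain ⟨h1, h2⟩ e (hn x hx hk)
  · have : x = (x.1, ⟨i + k, h2⟩) := Prod.ext rfl (Fin.ext (by simp only; omega))
    rw [this]
    exact X_mem_colonChain ⟨h1, h2⟩ e x.1

/-- Inserting a zero column at position `i + k` is the action of `skip`. Short words are excluded
because `I_e` is zero up to the stability index. -/
lemma eventuallySubset_words {i k : ℕ} {I : Chain K c} (hI : IsInvariant (i + k) I)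
    (e : Fin c → ℕ) :
    EventuallySubset (words i k I) (words i (k + 1) (colonChain (i + k) I e)) := by
  refine ⟨ind (i + k) I, fun w ⟨n, hn, hw⟩ hlen => ⟨n + 1, ?_, ?_⟩⟩
  · rw [PNat.add_coe, hn, PNat.val_ofNat]; omega
  · refine le_colonChain ⟨?_, ?_⟩ e (hI.monomial_mem (PNat.lt_add_right n 1).le
      (skip_mem_Inc (i + k)) (skip_lt (i + k) n) hw fun x => ?_)
    · rw [PNat.add_coe, hn, PNat.val_ofNat]; omega
    · rw [PNat.add_coe, hn, PNat.val_ofNat]; omega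
    · rw [expo_apply, expo_apply]
      simp only
      rw [col_skip]

/-- Every exponent vector without entries in the columns `i, …, i + k - 1` comes from a word. -/
lemma exists_word {i k : ℕ} {n : ℕ} (hn : i + k ≤ n) (b : Fin c × Fin n →₀ ℕ)
    (hb : ∀ x : Fin c × Fin n, i ≤ x.2 → (x.2 : ℕ) < i + k → b x = 0) :
    ∃ w : Word c i, w.2.length = n - (i + k) ∧ b = expo n (w.col k) := by
  refine ⟨⟨fun j t => b (t, ⟨j, by omega⟩),
    List.ofFn fun (j : Fin (n - (i + k))) t => b (t, ⟨i + k + j, by omega⟩)⟩, by simp, ?_⟩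
  ext x
  rw [expo_apply, Word.col]
  by_cases h1 : (x.2 : ℕ) < i
  · rw [dif_pos h1]
  · rw [dif_neg h1]
    by_cases h2 : (x.2 : ℕ) < i + k
    · rw [if_pos h2, hb x (by omega) h2]
      rfl
    · rw [if_neg h2, List.getD_eq_getElem _ _ (by simp; omega)]
      simp only [List.getElem_ofFn]
      congr 1
      exact Prod.ext rfl (Fin.ext (by simp only; omega))

/-- If the words do not grow, `I_{e,n+1}` consists of `I_n`, moved by skipping column `i + k`, and
the variables of that column, so `reg_eq` applies. -/
lemma reg_colonChain_eq {i k : ℕ} {I : Chain K c} (hI : (i + k, I) ∈ family K c)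
    (hcol : ContainsColumns i k I) {e : Fin c → ℕ}
    (he : (i + k + 1, colonChain (i + k) I e) ∈ family K c)
    (hsub : EventuallySubset (words i (k + 1) (colonChain (i + k) I e)) (words i k I)) :
    ∀ᶠ n : ℕ+ in atTop, (colonChain (i + k) I e (n + 1)).reg = (I n).reg := by
  obtain ⟨N, hN⟩ := hsub
  filter_upwards [hcol, eventually_ne_bot hI, eventually_lt_pnat (ind (i + k) I),
    eventually_lt_pnat (i + k + N)] with n hn hne h1 h2
  have hlt : ind (i + k) I < (n + 1 : ℕ+) ∧ i + k < (n + 1 : ℕ+) := by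
    rw [PNat.add_coe, PNat.val_ofNat]; omega
  have hinj := skipVar_injective c (i + k) n
  obtain ⟨a₀, ha₀⟩ := hne
  have hret : Koszul.IsRetract hinj (I n) (colonChain (i + k) I e (n + 1)) := by
    refine ⟨fun g hg => le_colonChain hlt e (hI.2.2 n (n + 1) (PNat.lt_add_right n 1).le
      ⟨_, skip_mem_Inc (i + k), skip_lt (i + k) n, g, hg, rfl⟩), ?_⟩
    obtain ⟨A, hA⟩ := he.2.1 (n + 1)
    have hA' : colonChain (i + k) I e (n + 1) =
      Ideal.span ((fun a => monomial a (1 : K)) '' A) := hA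
    suffices colonChain (i + k) I e (n + 1) ≤ (I n).comap (killCompl hinj) from this
    rw [hA', Ideal.span_le]
    rintro _ ⟨a, ha, rfl⟩
    change killCompl hinj (monomial a (1 : K)) ∈ I n
    by_cases hsupp : (a.support : Set _) ⊆ Set.range (skipVar c (i + k) n)
    swap
    · rw [killCompl_monomial_eq_zero_of_not_subset hinj _ hsupp]
      exact (I n).zero_mem
    obtain ⟨b, rfl⟩ : ∃ b, Finsupp.mapDomain _ b = a :=
      ⟨_, Finsupp.mapDomain_comapDomain _ hinj a hsupp⟩
    rw [killCompl_monomial_mapDomain]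
    -- A monomial meeting one of the columns `i, …, i + k - 1` lies in `I_n` because those variables
    -- do. Any other monomial is a word, to which `hsub` applies.
    by_cases hb : ∀ x : Fin c × Fin n, i ≤ x.2 → (x.2 : ℕ) < i + k → b x = 0
    swap
    · push Not at hb
      obtain ⟨x, hx1, hx2, hx3⟩ := hb
      refine monomial_mem_of_le (a := Finsupp.single x 1) ?_ (hn x hx1 hx2)
      rw [Finsupp.single_le_iff]
      exact Nat.one_le_iff_ne_zero.2 hx3
    obtain ⟨w, hw, rfl⟩ := exists_word (k := k) (by omega) b hb
    obtain ⟨n', hn', hw'⟩ := hN w ⟨n + 1, by rw [PNat.add_coe, PNat.val_ofNat, hw]; omega, by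
      rw [hA']
      rw [← mapDomain_skipVar_expo (by omega)]
      exact Ideal.subset_span ⟨_, ha, rfl⟩⟩ (by omega)
    obtain rfl : n' = n := PNat.eq (by omega)
    exact hw'
  refine hret.reg_eq (fun t ht => ?_)
    (f := monomial a₀ 1) ⟨ha₀, Koszul.monomial_mem_degPiece _ _⟩ (by simp)
  have ht2 : (t.2 : ℕ) = i + k := eq_of_notMem_range_skipVar (by omega) ht
  have : t = (t.1, ⟨i + k, hlt.2⟩) := Prod.ext rfl (Fin.ext ht2)
  rw [this]
  exact X_mem_colonChain hlt e t.1

/-- The number `i` stays fixed while `k` counts the columns adjoined so far. This keeps the words of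
all chains reached in one and the same set, so that their sets of words can be compared. -/
lemma eventuallyLinear_reg {𝓔 : Set (ℕ × Chain K c)} (h𝓔 : IsExtremal 𝓔) (i : ℕ)
    (U : UpperSets c i) : ∀ (k : ℕ) (I : Chain K c), (i + k, I) ∈ 𝓔 → ContainsColumns i k I →
      words i k I = U.1 → EventuallyLinear fun n => (I n).reg := by
  induction U using (wellFounded_eventuallySubset (c := c) i).induction with
  | _ U ih =>
  intro k I hI hcol hU
  obtain ⟨E, hE, hmax⟩ := h𝓔.2 _ _ hI
  have hfin : E.Finite := hmax.exists.elim fun n hn => finite_of_isGreatest hn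
  refine eventuallyLinear_of_isGreatest hfin hmax fun e he => ?_
  have heF := h𝓔.1 (hE e he)
  by_cases hsub : EventuallySubset (words i (k + 1) (colonChain (i + k) I e)) (words i k I)
  · right
    refine ⟨∑ t, (e t : ℤ), ?_⟩
    filter_upwards [reg_colonChain_eq (h𝓔.1 hI) hcol heF hsub] with n hn
    rw [hn]
  · left
    refine EventuallyLinear.add_const ?_ _
    refine ih ⟨words i (k + 1) (colonChain (i + k) I e),
      IsInvariant.mem_words_of_le heF.2.2⟩ ⟨?_, ?_⟩ (k + 1) _ (hE e he) (hcol.colonChain e) rfl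
    · rw [← hU]
      exact eventuallySubset_words (h𝓔.1 hI).2.2 e
    · rwa [← hU]

end IncChain

theorem mainTheorem4 {K : Type*} [Field K] {c : ℕ} (hc : 0 < c)
    (𝓔 : Set (ℕ × IncChain.Chain K c)) (h𝓔 : IncChain.IsExtremal 𝓔)
    (i : ℕ) (I : IncChain.Chain K c) (hI : (i, I) ∈ 𝓔) :
    ∃ C D : ℤ, ∀ᶠ n : ℕ+ in Filter.atTop, (I n).reg = C * (n : ℤ) + D :=
  IncChain.eventuallyLinear_reg h𝓔 i
    ⟨IncChain.words i 0 I, IncChain.IsInvariant.mem_words_of_le (h𝓔.1 hI).2.2⟩ 0 I hI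
    (Filter.Eventually.of_forall fun n x h1 h2 => absurd h2 (by omega)) rfl
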